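/- **Theorem (Asymptotic Synchronization Criterion).** Let $n\ge 2$ and let $\mathcal L\in\mathbb R^{n\times n}$ be the Laplacian matrix of a connected undirected graph on $\{1,\dots,n\}$ with positive edge weights. Let $g_1,\dots,g_n$ be proper rational functions with complex coefficients (the agents), $\mathcal G(s)=\mathrm{diag}(g_1(s),\dots,g_n(s))$, $\Gamma=2\,\mathrm{diag}(\mathcal L_{11},\dots,\mathcal L_{nn})$, and $$\mathcal G'(s)=\Gamma^{1/2}\mathcal G(s)\Gamma^{1/2},\qquad \mathcal L'=\Gamma^{-1/2}\mathcal L\,\Gamma^{-1/2}.$$ Let $u_1,\dots,u_n$ be an orthonormal basis of $\mathbb R^n$ of eigenvectors of $\mathcal L'$, ordered by ascending eigenvalues $0=\mu_1<\mu_2\le\cdots\le\mu_n$. *Closed loop and modes.* Consider the closed-loop system $\delta'=\mathcal G'(s)(d'-\mathcal L'\delta')$ with return ratio $-\mathcal L'\mathcal G'(s)$. Its mode $i$ is called stable if all entries of the row $u_i^{\mathsf T}\big(I+\mathcal G'(s)\mathcal L'\big)^{-1}\mathcal G'(s)$, i.e. the transfer functions from $d'$ to the modal state $u_i^{\mathsf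 T}\delta'$, have no poles in the closed right half-plane. The system achieves *asymptotic synchronization on the average mode* if all interarea modes $i=2,\dots,n$ are stable. *Characteristic polynomials.* For a rational matrix $H$ let $\phi_{ol}$ be its Smith–McMillan pole polynomial, i.e. the monic least common denominator of all minors of $H$ of all orders, and define $\phi_{cl}$ by $\det(I+H)=\phi_{cl}/\phi_{ol}$. The poles of $H$, with multiplicity, are the roots of $\phi_{ol}$; a pole is unstable if it lies in the open right half-plane. *Assumptions.* 1. The feedback loop is well posed: $\det\big(I+\mathcal L'\mathcal G'(\infty)\big)\neq 0$. 2. There is no unstable pole cancellation in the product $\mathcal L'\mathcal G'$: every point of the open right half-plane has the same multiplicity as a pole of $\mathcal L'\mathcal G'$ and as a pole of $\mathcal G'$. 3. There is no cancellation on the imaginary axis in $\det(I+\mathcal L'\mathcal G')=\phi_{cl}/\phi_{ol}$: the polynomials $\phi_{ol}$ and $\phi_{cl}$ of $H=\mathcal L'\mathcal G'$ have no common root on the imaginary axis. 4. $\mathcal G'(s)$ has $N$ unstable poles, counted with multiplicity. *Nyquist contour and eigenloci.* For $R,\varepsilon>0$ let $\mathcal D_{R,\varepsilon}$ be the contour that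 goes up the imaginary axis from $-iR$ to $iR$, except that it avoids every pole of $\mathcal L'\mathcal G'$ on the imaginary axis by a semicircular indentation of radius $\varepsilon$ into the right half-plane, and then returns along the semicircle of radius $R$ in the right half-plane; it is traversed clockwise. Along the contour, the eigenvalues of $\mathcal L'\mathcal G'(s)$, with multiplicity, form continuous branches $\lambda_1\equiv 0,\lambda_2,\dots,\lambda_n$ (the eigenloci). The loci $\lambda_2,\dots,\lambda_n$, *taken together, encircle $-1$ exactly $N$ times anticlockwise* if none of them meets $-1$ and the changes of the continuous arguments of $1+\lambda_2,\dots,1+\lambda_n$ along the contour add up to $2\pi N$. *Conclusion.* The closed-loop system with return ratio $-\mathcal L'\mathcal G'(s)$ achieves asymptotic synchronization on the average mode if and only if, for all sufficiently large $R$ and all sufficiently small $\varepsilon>0$, the eigenloci $\lambda_2,\dots,\lambda_n$ of $\mathcal L'\mathcal G'(s)$, taken together, encircle $-1$ exactly $N$ times anticlockwise as $s$ goes once clockwise around $\mathcal D_{R,\varepsilon}$. -/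

import Mathlib

open Polynomial

noncomputable section

namespace NetworkSync

/-- Square transfer matrices with rational entries. -/
abbrev TransferMatrix (n : ℕ) := Matrix (Fin n) (Fin n) (RatFunc ℂ)

/-- A constant real matrix, regarded as a transfer matrix. -/
def const {n : ℕ} (A : Matrix (Fin n) (Fin n) ℝ) : TransferMatrix n :=
  A.map fun a => RatFunc.C (a : ℂ)

/-- A rational transfer function is proper if it stays bounded as `s → ∞`. -/
def IsProper (r : RatFunc ℂ) : Prop := r.num.natDegree ≤ r.denom.natDegree

/-- The value at `s = ∞` of a proper rational function (recall that `denom` is monic). -/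
def valueAtInfty (r : RatFunc ℂ) : ℂ := r.num.coeff r.denom.natDegree

/-- A rational transfer function is stable if it has no pole in the closed right half-plane. -/
def IsStable (r : RatFunc ℂ) : Prop := ∀ p : ℂ, 0 ≤ p.re → ¬ r.denom.IsRoot p

/-! ### Smith-McMillan poles, characteristic polynomials -/

/-- The open-loop characteristic polynomial (Smith-McMillan pole polynomial) of a rational
matrix: the monic least common denominator of all its minors of all orders. Repeated indices give
vanishing minors and a permutation of the indices only changes the sign, so it does no harm to
range over all maps `Fin k → Fin n`. -/
def olCharPoly {n : ℕ} (H : TransferMatrix n) : ℂ[X] :=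
  (Finset.univ : Finset (Fin (n + 1))).lcm fun k =>
    (Finset.univ : Finset ((Fin k → Fin n) × (Fin k → Fin n))).lcm fun e =>
      (H.submatrix e.1 e.2).det.denom

/-- The closed-loop characteristic polynomial `φ_cl` of the loop with return ratio `-H`, defined by
`det (I + H) = φ_cl / φ_ol`. -/
def clCharPoly {n : ℕ} (H : TransferMatrix n) : ℂ[X] :=
  (algebraMap ℂ[X] (RatFunc ℂ) (olCharPoly H) * (1 + H).det).num

open Classical in
/-- The number of unstable (open right half-plane) Smith-McMillan poles, with multiplicity. -/
def numUnstablePoles {n : ℕ} (H : TransferMatrix n) : ℕ :=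
  ((olCharPoly H).roots.filter fun p => 0 < p.re).card

open Classical in
/-- The real numbers `ω` for which `iω` is an open-loop pole of `H`. -/
def axisPoles {n : ℕ} (H : TransferMatrix n) : Finset ℝ :=
  ((olCharPoly H).roots.toFinset.filter fun p => p.re = 0).image Complex.im

/-! ### The network -/

/-- `L` is the Laplacian matrix of a connected undirected graph with positive edge weights
`-L i j`. -/
structure IsConnectedLaplacian {n : ℕ} (L : Matrix (Fin n) (Fin n) ℝ) : Prop where
  symm : L.IsSymm
  off_diag : ∀ i j, i ≠ j → L i j ≤ 0
  row_sum : ∀ i, ∑ j, L i j = 0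
  connected : (SimpleGraph.fromRel fun i j => L i j ≠ 0).Connected

/-- `γ_i = 2 L_ii`. -/
def gam {n : ℕ} (L : Matrix (Fin n) (Fin n) ℝ) (i : Fin n) : ℝ := 2 * L i i

/-- `Γ^(1/2)` -/
def sqrtGam {n : ℕ} (L : Matrix (Fin n) (Fin n) ℝ) : Matrix (Fin n) (Fin n) ℝ :=
  Matrix.diagonal fun i => √(gam L i)

/-- `Γ^(-1/2)` -/
def invSqrtGam {n : ℕ} (L : Matrix (Fin n) (Fin n) ℝ) : Matrix (Fin n) (Fin n) ℝ :=
  Matrix.diagonal fun i => (√(gam L i))⁻¹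

/-- The normalized network matrix `L' = Γ^(-1/2) L Γ^(-1/2)`. -/
def normLaplacian {n : ℕ} (L : Matrix (Fin n) (Fin n) ℝ) : Matrix (Fin n) (Fin n) ℝ :=
  invSqrtGam L * L * invSqrtGam L

/-- The normalized agent matrix `G' = Γ^(1/2) diag(g_1, …, g_n) Γ^(1/2)`. -/
def normAgents {n : ℕ} (L : Matrix (Fin n) (Fin n) ℝ) (g : Fin n → RatFunc ℂ) :
    TransferMatrix n :=
  const (sqrtGam L) * Matrix.diagonal g * const (sqrtGam L)

/-- The matrix `L' G'`, i.e. minus the return ratio. -/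
def loopMatrix {n : ℕ} (L : Matrix (Fin n) (Fin n) ℝ) (g : Fin n → RatFunc ℂ) :
    TransferMatrix n :=
  const (normLaplacian L) * normAgents L g

/-- The limit of `L' G'(s)` as `s → ∞`. -/
def loopMatrixAtInfty {n : ℕ} (L : Matrix (Fin n) (Fin n) ℝ) (g : Fin n → RatFunc ℂ) :
    Matrix (Fin n) (Fin n) ℂ :=
  (loopMatrix L g).map valueAtInfty

/-- Well-posedness of the feedback loop: `I + L' G'(∞)` is invertible. -/
def WellPosed {n : ℕ} (L : Matrix (Fin n) (Fin n) ℝ) (g : Fin n → RatFunc ℂ) : Prop :=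
  (1 + loopMatrixAtInfty L g).det ≠ 0

/-- No unstable pole of the agents is cancelled when the product `L' G'` is formed: every point of
the open right half-plane has the same Smith-McMillan multiplicity as a pole of `L' G'` and as a
pole of `G'`. -/
def NoUnstableCancellation {n : ℕ} (L : Matrix (Fin n) (Fin n) ℝ) (g : Fin n → RatFunc ℂ) :
    Prop :=
  ∀ p : ℂ, 0 < p.re →
    (olCharPoly (loopMatrix L g)).rootMultiplicity p =
      (olCharPoly (normAgents L g)).rootMultiplicity p

/-- No cancellation on the imaginary axis in `det (I + L' G') = φ_cl / φ_ol`. -/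
def NoAxisCancellation {n : ℕ} (L : Matrix (Fin n) (Fin n) ℝ) (g : Fin n → RatFunc ℂ) : Prop :=
  ∀ p : ℂ, p.re = 0 →
    ¬ ((olCharPoly (loopMatrix L g)).IsRoot p ∧ (clCharPoly (loopMatrix L g)).IsRoot p)

/-- The columns of `U` are orthonormal eigenvectors `u_1, …, u_n` of `A`, in the order of
ascending eigenvalues `μ_1 ≤ ⋯ ≤ μ_n`. -/
structure IsModalDecomposition {n : ℕ} (A U : Matrix (Fin n) (Fin n) ℝ) (μ : Fin n → ℝ) :
    Prop where
  orthonormal : U.transpose * U = 1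
  ascending : Monotone μ
  decomp : A = U * Matrix.diagonal μ * U.transpose

/-- The closed-loop transfer matrix from `d'` to `δ'` of the network `δ' = G' (d' - L' δ')`. -/
def closedLoop {n : ℕ} (L : Matrix (Fin n) (Fin n) ℝ) (g : Fin n → RatFunc ℂ) :
    TransferMatrix n :=
  (1 + normAgents L g * const (normLaplacian L))⁻¹ * normAgents L g

/-- Mode `i` is stable: the closed-loop transfer functions from all components of `d'` to the modal
phase angle `u_iᵀ δ'` are stable (then so are those to the modal frequency `u_iᵀ s δ'`). -/
def ModeStable {n : ℕ} (L : Matrix (Fin n) (Fin n) ℝ) (g : Fin n → RatFunc ℂ)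
    (U : Matrix (Fin n) (Fin n) ℝ) (i : Fin n) : Prop :=
  ∀ j, IsStable ((const U.transpose * closedLoop L g) i j)

/-- Asymptotic synchronization on the average mode: all modes other than the first one, i.e. all
interarea modes, are stable. -/
def AsymptoticSync {m : ℕ} (L : Matrix (Fin (m + 1)) (Fin (m + 1)) ℝ)
    (g : Fin (m + 1) → RatFunc ℂ) (U : Matrix (Fin (m + 1)) (Fin (m + 1)) ℝ) : Prop :=
  ∀ i : Fin m, ModeStable L g U i.succ

/-! ### The Nyquist contour and encirclements -/

/-- The Nyquist contour, parametrized by `t ∈ [0, 2]` and traversed clockwise: first up the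
imaginary axis from `-iR` to `iR`, with semicircular indentations of radius `ε` into the right
half-plane around the points `iω`, `ω ∈ P`, and then back along the semicircle of radius `R` in the
right half-plane. (`√x = 0` for `x ≤ 0`, so each summand is the indentation at one point.) -/
def nyquistContour (P : Finset ℝ) (R ε t : ℝ) : ℂ :=
  if t ≤ 1 then
    ((∑ ω ∈ P, √(ε ^ 2 - (R * (2 * t - 1) - ω) ^ 2) : ℝ) : ℂ) + (R * (2 * t - 1) : ℝ) * Complex.I
  else
    R * Complex.exp ((Real.pi * (3 / 2 - t) : ℝ) * Complex.I)

/-- The value `H(s)` of a transfer matrix at a point which is not a pole. -/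
def evalAt {n : ℕ} (H : TransferMatrix n) (s : ℂ) : Matrix (Fin n) (Fin n) ℂ :=
  H.map (RatFunc.eval (RingHom.id ℂ) s)

/-- `l 0, …, l m` are the eigenloci of `H` along the path `c : [0, 2] → ℂ`: continuous branches of
the eigenvalues of `H (c t)`, with multiplicity, the first one being the eigenvalue that vanishes
identically. -/
structure IsEigenloci {m : ℕ} (H : TransferMatrix (m + 1)) (c : ℝ → ℂ)
    (l : Fin (m + 1) → ℝ → ℂ) : Prop where
  cont : ∀ i, ContinuousOn (l i) (Set.Icc 0 2)
  first : ∀ t ∈ Set.Icc (0 : ℝ) 2, l 0 t = 0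
  eigen : ∀ t ∈ Set.Icc (0 : ℝ) 2, (evalAt H (c t)).charpoly = ∏ i, (X - C (l i t))

/-- `θ` is a continuous argument of `z - (-1)` along the path `z : [0, 2] → ℂ`. -/
structure IsArgumentAboutNegOne (z : ℝ → ℂ) (θ : ℝ → ℝ) : Prop where
  cont : ContinuousOn θ (Set.Icc 0 2)
  polar : ∀ t ∈ Set.Icc (0 : ℝ) 2, 1 + z t = ‖1 + z t‖ * Complex.exp (θ t * Complex.I)

/-- The eigenloci `λ_2, …, λ_n` of `H` along the path `c : [0, 2] → ℂ` do not meet `-1` and, taken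
together, encircle it `N` times anticlockwise. (The single branches need not be closed curves: they
may be permuted after one revolution. Only the sum of their argument changes is a multiple
of `2π`.) -/
def EigenlociEncircle {m : ℕ} (H : TransferMatrix (m + 1)) (c : ℝ → ℂ) (N : ℤ) : Prop :=
  ∃ (l : Fin (m + 1) → ℝ → ℂ) (θ : Fin m → ℝ → ℝ),
    IsEigenloci H c l ∧
    (∀ i : Fin m, ∀ t ∈ Set.Icc (0 : ℝ) 2, l i.succ t ≠ -1) ∧
    (∀ i : Fin m, IsArgumentAboutNegOne (l i.succ) (θ i)) ∧
    ∑ i, (θ i 2 - θ i 0) = 2 * Real.pi * N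

end NetworkSync

end

/-!
Write `H = L' G'`, `φ_ol` and `φ_cl` for its characteristic polynomials, and `T` for the
closed-loop transfer matrix.

*Modes and characteristic polynomial.* The identity `L' T = I - (I + H)⁻¹` reads `diag(μ) Uᵀ T =
Uᵀ (I - (I + H)⁻¹)` in modal coordinates. Since the graph is connected, `μ_1 = 0` and `μ_i > 0`
for `i ≥ 2`, so the interarea modes are stable if and only if all entries of `(I + H)⁻¹` are
(`asymptoticSync_iff`). These entries are polynomials divided by `φ_cl`
(`inv_one_add_mem_regularAt`). Conversely, where `(I + H)⁻¹` is regular, `det (I + H) = φ_cl /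
φ_ol` divides all minors of `I + H`, by a Schur complement. At a root `p` of `φ_cl`, the
polynomial `φ_ol / (X - p)` would then still be a common denominator of the minors of `I + H`,
hence of those of `H`, which contradicts the minimality of `φ_ol` (`not_isRoot_clCharPoly`). Hence
synchronization means that `φ_cl` has no root in the closed right half-plane.

*Encirclements.* As the locus `λ_1` vanishes, `∏_{i ≥ 2} (1 + λ_i) = φ_cl / φ_ol` along the
contour. The contour goes once clockwise around the roots of `φ_cl` and `φ_ol` in the open right
half-plane and not around the others (`IsAdapted.hasArgChange_eval`), so the arguments of the `1 +
λ_i` change by `2π (N - Z)` in total, where `Z` is the number of unstable roots of `φ_cl`. This is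
`2π N` if and only if `Z = 0`. By assumption, roots of `φ_cl` on the imaginary axis are not poles
of `H`, so the contour runs through them, and there some locus meets `-1`
(`re_ne_zero_of_isRoot_clCharPoly`).

*Existence of the loci.* The criterion also asserts that continuous branches of the eigenvalues
exist, which is `exists_continuousOn_roots`: the roots of a continuous path of monic polynomials
can be followed continuously. The branches are limits of selections along finer and finer grids.
-/

namespace NetworkSync

open Filter Topology Polynomial

noncomputable section

/-! ### Continuous branches of the roots of a path of polynomials -/

/-- A monic complex polynomial of degree `m` has an `m`-tuple of roots. -/
theorem exists_eq_prod_X_sub_C {m : ℕ} {p : ℂ[X]} (hp : p.Monic) (hd : p.natDegree = m) :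
    ∃ a : Fin m → ℂ, p = ∏ i, (X - C (a i)) := by
  have hs := IsAlgClosed.splits p
  have hlen : p.roots.toList.length = m := by
    rw [Multiset.length_toList, ← hd, hs.natDegree_eq_card_roots]
  subst hlen
  refine ⟨fun i => p.roots.toList.get i, ?_⟩
  conv_lhs => rw [hs.eq_prod_roots_of_monic hp, ← Multiset.coe_toList p.roots]
  rw [Multiset.map_coe, Multiset.prod_coe, ← List.prod_ofFn]
  congr 1
  apply List.ext_get <;> simp

/-- A tuple of roots of a monic polynomial is unique up to a permutation. -/
theorem exists_perm_of_prod_X_sub_C_eq {m : ℕ} {a b : Fin m → ℂ}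
    (h : ∏ i, (X - C (a i)) = ∏ i, (X - C (b i))) :
    ∃ σ : Equiv.Perm (Fin m), a = b ∘ σ := by
  induction m with
  | zero => exact ⟨1, Subsingleton.elim _ _⟩
  | succ m ih =>
    obtain ⟨j, hj⟩ : ∃ j, b j = a 0 := by
      have := congrArg (eval (a 0)) h
      rw [eval_prod, eval_prod, Finset.prod_eq_zero (Finset.mem_univ 0) (by simp)] at this
      obtain ⟨j, -, hj⟩ := Finset.prod_eq_zero_iff.1 this.symm
      exact ⟨j, by rw [eval_sub, eval_X, eval_C] at hj; exact (sub_eq_zero.1 hj).symm⟩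
    rw [Fin.prod_univ_succ, Fin.prod_univ_succAbove _ j, hj] at h
    obtain ⟨σ, hσ⟩ := ih (b := fun i => b (j.succAbove i))
      (mul_left_cancel₀ (X_sub_C_ne_zero (a 0)) h)
    refine ⟨((finSuccEquiv' 0).trans (Equiv.optionCongr σ)).trans (finSuccEquiv' j).symm, ?_⟩
    funext i
    refine Fin.cases ?_ (fun i => ?_) i
    · simp [hj]
    · have h0 := congrFun hσ i
      have : finSuccEquiv' (0 : Fin (m + 1)) i.succ = some i := by
        rw [← Fin.succAbove_zero]; exact finSuccEquiv'_succAbove 0 i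
      simpa [this] using h0

/-- A chain of points with steps of length at most `η`, all of whose points are `η`-close to a
finite set `F`, stays within `3 |F| η` of its starting point: after the last visit near one
point of `F`, the rest of the chain is close to the remaining points. -/
theorem dist_le_of_chain {E : Type*} [PseudoMetricSpace E] {η : ℝ} (hη : 0 ≤ η) (F : Finset E)
    (x : ℕ → E) {j k : ℕ} (hjk : j ≤ k) (hstep : ∀ l, j ≤ l → l < k → dist (x l) (x (l + 1)) ≤ η)
    (hF : ∀ l, j ≤ l → l ≤ k → ∃ f ∈ F, dist (x l) f ≤ η) :
    dist (x j) (x k) ≤ 3 * F.card * η := by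
  classical
  induction hc : F.card generalizing F j with
  | zero =>
    obtain ⟨f, hf, -⟩ := hF j le_rfl hjk
    rw [Finset.card_eq_zero.1 hc] at hf
    simp at hf
  | succ n ih =>
    obtain ⟨f, hf, hjf⟩ := hF j le_rfl hjk
    let P : ℕ → Prop := fun l => j ≤ l ∧ dist (x l) f ≤ η
    have hPj : P j := ⟨le_rfl, hjf⟩
    -- the last index at which the chain is close to `f`
    obtain ⟨l, hl⟩ : ∃ l, l = Nat.findGreatest P k := ⟨_, rfl⟩
    have hPl : P l := hl ▸ Nat.findGreatest_spec hjk hPj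
    have hlk : l ≤ k := hl ▸ Nat.findGreatest_le k
    have hmax : ∀ i, l < i → i ≤ k → ¬ P i := fun i hi hik =>
      Nat.findGreatest_is_greatest (hl ▸ hi) hik
    have h1 : dist (x j) (x l) ≤ 2 * η := by
      have := dist_triangle_right (x j) (x l) f
      linarith [hPl.2]
    have hn : (0 : ℝ) ≤ 3 * n * η := by positivity
    rcases hlk.eq_or_lt with rfl | hlt
    · push_cast
      linarith
    · have h2 := hstep l hPl.1 hlt
      have h3 := ih (F.erase f) (j := l + 1) hlt
        (fun i hi hik => hstep i (by have := hPl.1; omega) hik)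
        (fun i hi hik => by
          obtain ⟨g, hg, hd⟩ := hF i (by have := hPl.1; omega) hik
          refine ⟨g, Finset.mem_erase.2 ⟨?_, hg⟩, hd⟩
          rintro rfl
          exact hmax i hi hik ⟨by have := hPl.1; omega, hd⟩)
        (by rw [Finset.card_erase_of_mem hf, hc]; rfl)
      have := dist_triangle4 (x j) (x l) (x (l + 1)) (x k)
      push_cast
      linarith

/-- The roots of a path of monic polynomials move uniformly continuously on a compact parameter
interval, when root tuples are compared up to a permutation. -/
theorem exists_perm_dist_lt {m : ℕ} {p : ℝ → ℂ[X]} {S : Set ℂ} (hS : S.Infinite)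
    (hc : ∀ x ∈ S, Continuous fun t => (p t).eval x) {B : ℝ}
    (hB : ∀ t z, (p t).IsRoot z → ‖z‖ ≤ B) (T : ℝ) {η : ℝ} (hη : 0 < η) :
    ∃ δ > 0, ∀ s ∈ Set.Icc 0 T, ∀ t ∈ Set.Icc 0 T, |s - t| < δ → ∀ a b : Fin m → ℂ,
      p s = ∏ i, (X - C (a i)) → p t = ∏ i, (X - C (b i)) →
        ∃ σ : Equiv.Perm (Fin m), dist a (b ∘ σ) < η := by
  have hball : ∀ t (a : Fin m → ℂ), p t = ∏ i, (X - C (a i)) → a ∈ Metric.closedBall 0 |B| := by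
    intro t a ha
    rw [mem_closedBall_zero_iff, pi_norm_le_iff_of_nonneg (abs_nonneg B)]
    refine fun i => (hB t _ ?_).trans (le_abs_self B)
    rw [ha, IsRoot, eval_prod]
    exact Finset.prod_eq_zero (Finset.mem_univ i) (by simp)
  have heq : ∀ t (a : Fin m → ℂ), p t = ∏ i, (X - C (a i)) ↔
      ∀ x ∈ S, (p t).eval x = ∏ i, (x - a i) := by
    refine fun t a => ⟨fun h x _ => by rw [h, eval_prod]; simp, fun h => ?_⟩
    refine eq_of_infinite_eval_eq _ _ (hS.mono fun x hx => ?_)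
    rw [Set.mem_ofPred_eq, h x hx, eval_prod]
    simp
  -- the compact set of pairs of parameters and root tuples which are not `η`-close
  let K : Set ((ℝ × ℝ) × (Fin m → ℂ) × (Fin m → ℂ)) :=
    ((Set.Icc 0 T ×ˢ Set.Icc 0 T) ×ˢ (Metric.closedBall 0 |B| ×ˢ Metric.closedBall 0 |B|)) ∩
    {q | (∀ x ∈ S, (p q.1.1).eval x = ∏ i, (x - q.2.1 i)) ∧
      (∀ x ∈ S, (p q.1.2).eval x = ∏ i, (x - q.2.2 i)) ∧
      ∀ σ : Equiv.Perm (Fin m), η ≤ dist q.2.1 (q.2.2 ∘ σ)}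
  have hK : IsCompact K := by
    refine IsCompact.inter_right ((isCompact_Icc.prod isCompact_Icc).prod
      ((isCompact_closedBall _ _).prod (isCompact_closedBall _ _))) ?_
    simp only [Set.ofPred_and, Set.ofPred_forall]
    refine IsClosed.inter ?_ (IsClosed.inter ?_ ?_)
    · refine isClosed_iInter fun x => isClosed_iInter fun hx => isClosed_eq
        ((hc x hx).comp (by fun_prop)) (by fun_prop)
    · refine isClosed_iInter fun x => isClosed_iInter fun hx => isClosed_eq
        ((hc x hx).comp (by fun_prop)) (by fun_prop)
    · refine isClosed_iInter fun σ => isClosed_le continuous_const ?_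
      refine Continuous.dist (by fun_prop) ?_
      exact continuous_pi fun i => (continuous_apply (σ i)).comp (by fun_prop)
  have hpos : ∀ q ∈ K, 0 < |q.1.1 - q.1.2| := by
    rintro ⟨⟨s, t⟩, a, b⟩ ⟨-, ha, hb, hσ⟩
    refine abs_pos.2 fun h0 => ?_
    obtain rfl : s = t := sub_eq_zero.1 h0
    obtain ⟨σ, hab⟩ := exists_perm_of_prod_X_sub_C_eq
      (((heq s a).2 ha).symm.trans ((heq s b).2 hb))
    have h1 : η ≤ dist a (b ∘ σ) := hσ σ
    rw [← hab, dist_self] at h1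
    exact absurd h1 (not_le.2 hη)
  have key : ∃ δ > 0, ∀ q ∈ K, δ ≤ |q.1.1 - q.1.2| := by
    rcases K.eq_empty_or_nonempty with h0 | hne
    · exact ⟨1, one_pos, by simp [h0]⟩
    · obtain ⟨q, hq, hmin⟩ := hK.exists_isMinOn hne
        (f := fun q => |q.1.1 - q.1.2|) (by fun_prop)
      exact ⟨_, hpos q hq, fun r hr => hmin hr⟩
  obtain ⟨δ, hδ, hδK⟩ := key
  refine ⟨δ, hδ, fun s hs t ht hst a b ha hb => ?_⟩
  by_contra! hcon
  exact absurd (hδK ((s, t), a, b) ⟨⟨⟨hs, ht⟩, hball s a ha, hball t b hb⟩,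
    (heq s a).1 ha, (heq t b).1 hb, hcon⟩) (not_le.2 hst)

/-- Root tuples can be chosen along a sequence of parameters in such a way that each tuple is, among
all the orderings of the roots, one that is closest to its predecessor. -/
theorem exists_greedy_roots {m : ℕ} {p : ℝ → ℂ[X]} (hm : ∀ t, (p t).Monic)
    (hd : ∀ t, (p t).natDegree = m) (τ : ℕ → ℝ) :
    ∃ x : ℕ → Fin m → ℂ, (∀ k, p (τ k) = ∏ i, (X - C (x k i))) ∧
      ∀ k b, p (τ (k + 1)) = ∏ i, (X - C (b i)) → dist (x k) (x (k + 1)) ≤ dist (x k) b := by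
  have hnext : ∀ (a : Fin m → ℂ) (t : ℝ), ∃ c : Fin m → ℂ, p t = ∏ i, (X - C (c i)) ∧
      ∀ b, p t = ∏ i, (X - C (b i)) → dist a c ≤ dist a b := by
    intro a t
    obtain ⟨b₀, hb₀⟩ := exists_eq_prod_X_sub_C (hm t) (hd t)
    obtain ⟨σ, hσ⟩ := Finite.exists_min fun σ : Equiv.Perm (Fin m) => dist a (b₀ ∘ σ)
    refine ⟨b₀ ∘ σ, ?_, fun b hb => ?_⟩
    · rw [hb₀]
      exact (Equiv.prod_comp σ fun i => (X - C (b₀ i))).symm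
    · obtain ⟨ρ, rfl⟩ := exists_perm_of_prod_X_sub_C_eq (hb.symm.trans hb₀)
      exact hσ ρ
  choose nxt h1 h2 using hnext
  obtain ⟨a₀, ha₀⟩ := exists_eq_prod_X_sub_C (hm (τ 0)) (hd (τ 0))
  obtain ⟨x, hx0, hxs⟩ : ∃ x : ℕ → Fin m → ℂ, x 0 = a₀ ∧ ∀ k, x (k + 1) = nxt (x k) (τ (k + 1)) :=
    ⟨fun k => Nat.rec (motive := fun _ => Fin m → ℂ) a₀ (fun k a => nxt a (τ (k + 1))) k,
      rfl, fun _ => rfl⟩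
  refine ⟨x, fun k => ?_, fun k b hb => ?_⟩
  · cases k with
    | zero => rw [hx0]; exact ha₀
    | succ k => rw [hxs]; exact h1 _ _
  · rw [hxs]
    exact h2 _ _ b hb

/-- The roots of a continuous path of monic polynomials can be followed continuously. Greedy
selections on finer and finer grids are equicontinuous, because a chain of roots with small steps
cannot leave the neighbourhood of the finitely many roots at its starting time; their limit along
an ultrafilter is a continuous choice of the roots. -/
theorem exists_continuousOn_roots {m : ℕ} {p : ℝ → ℂ[X]} (hm : ∀ t, (p t).Monic)
    (hd : ∀ t, (p t).natDegree = m) {S : Set ℂ} (hS : S.Infinite)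
    (hc : ∀ x ∈ S, Continuous fun t => (p t).eval x) {B : ℝ}
    (hB : ∀ t z, (p t).IsRoot z → ‖z‖ ≤ B) (T : ℝ) :
    ∃ l : Fin m → ℝ → ℂ, (∀ i, ContinuousOn (l i) (Set.Icc 0 T)) ∧
      ∀ t ∈ Set.Icc 0 T, p t = ∏ i, (X - C (l i t)) := by
  choose x hx hmin using fun N : ℕ => exists_greedy_roots hm hd fun k => (k : ℝ) / (N + 1)
  have hN : ∀ N : ℕ, (0 : ℝ) < N + 1 := fun N => by positivity
  let κ : ℕ → ℝ → ℕ := fun N t => ⌊t * (N + 1)⌋₊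
  have hκ1 : ∀ N : ℕ, ∀ t, 0 ≤ t → (κ N t : ℝ) / (N + 1) ≤ t := fun N t ht => by
    rw [div_le_iff₀ (hN N)]
    exact Nat.floor_le (mul_nonneg ht (hN N).le)
  have hκ2 : ∀ N : ℕ, ∀ t, t - 1 / (N + 1) < (κ N t : ℝ) / (N + 1) := fun N t => by
    have := Nat.lt_floor_add_one (t * (N + 1 : ℝ))
    rw [sub_lt_iff_lt_add, ← add_div, lt_div_iff₀ (hN N)]
    exact this
  have hequi : ∀ η > 0, ∃ δ > 0, ∀ s ∈ Set.Icc 0 T, ∀ t ∈ Set.Icc 0 T, s ≤ t → t - s < δ →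
      ∀ᶠ N in atTop, ∀ i, dist (x N (κ N s) i) (x N (κ N t) i) ≤ 3 * m * η := by
    intro η hη
    obtain ⟨δ, hδ, hum⟩ := exists_perm_dist_lt (m := m) hS hc hB T hη
    refine ⟨δ / 2, half_pos hδ, fun s hs t ht hst hlt => ?_⟩
    have hsmall : ∀ᶠ N : ℕ in atTop, 1 / ((N : ℝ) + 1) < δ / 2 :=
      tendsto_one_div_add_atTop_nhds_zero_nat.eventually (gt_mem_nhds (half_pos hδ))
    filter_upwards [hsmall] with N hNδ i
    have hjk : κ N s ≤ κ N t :=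
      Nat.floor_le_floor (mul_le_mul_of_nonneg_right hst (hN N).le)
    have hmono : ∀ {a b : ℕ}, a ≤ b → (a : ℝ) / (N + 1) ≤ (b : ℝ) / (N + 1) := fun h =>
      div_le_div_of_nonneg_right (Nat.cast_le.2 h) (hN N).le
    have htime : ∀ l, l ≤ κ N t → (l : ℝ) / (N + 1) ∈ Set.Icc 0 T := fun l hl =>
      ⟨div_nonneg l.cast_nonneg (hN N).le, (hmono hl).trans ((hκ1 N t ht.1).trans ht.2)⟩
    have hstep : ∀ l, κ N s ≤ l → l < κ N t → dist (x N l i) (x N (l + 1) i) ≤ η := by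
      intro l _ hl
      obtain ⟨σ, hσ⟩ := hum _ (htime l hl.le) _ (htime (l + 1) hl)
        (by
          have : ((l : ℝ) / (N + 1) - ((l + 1 : ℕ) : ℝ) / (N + 1)) = -(1 / (N + 1)) := by
            push_cast; ring
          rw [this, abs_neg, abs_of_pos (one_div_pos.2 (hN N))]
          linarith) _ _ (hx N l) (hx N (l + 1))
      have h1 := hmin N l (x N (l + 1) ∘ σ) (by
        rw [hx N (l + 1)]
        exact (Equiv.prod_comp σ fun i => (X - C (x N (l + 1) i))).symm)
      exact (dist_le_pi_dist _ _ i).trans (h1.trans hσ.le)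
    have hF : ∀ l, κ N s ≤ l → l ≤ κ N t →
        ∃ f ∈ Finset.univ.image (x N (κ N s)), dist (x N l i) f ≤ η := by
      intro l h1 h2
      obtain ⟨σ, hσ⟩ := hum _ (htime l h2) _ (htime _ hjk)
        (by
          have h3 := hmono h1
          have h4 := hmono h2
          have h5 := hκ1 N t ht.1
          have h6 := hκ2 N s
          rw [abs_of_nonneg (by linarith)]
          linarith) _ _ (hx N l) (hx N _)
      exact ⟨_, Finset.mem_image_of_mem _ (Finset.mem_univ (σ i)),
        (dist_le_pi_dist _ _ i).trans hσ.le⟩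
    refine (dist_le_of_chain hη.le _ (fun l => x N l i) hjk hstep hF).trans ?_
    have hcard : (Finset.univ.image (x N (κ N s))).card ≤ m :=
      Finset.card_image_le.trans (by simp)
    have : ((Finset.univ.image (x N (κ N s))).card : ℝ) ≤ m := Nat.cast_le.2 hcard
    gcongr
  have hlim : ∀ t, ∃ a : Fin m → ℂ,
      Tendsto (fun N => x N (κ N t)) (hyperfilter ℕ) (𝓝 a) := by
    intro t
    have hmem : ∀ N, x N (κ N t) ∈ Metric.closedBall (0 : Fin m → ℂ) |B| := by
      intro N
      rw [mem_closedBall_zero_iff, pi_norm_le_iff_of_nonneg (abs_nonneg B)]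
      refine fun i => (hB ((κ N t : ℝ) / (N + 1)) _ ?_).trans (le_abs_self B)
      rw [hx N, IsRoot, eval_prod]
      exact Finset.prod_eq_zero (Finset.mem_univ i) (by simp)
    obtain ⟨a, -, ha⟩ := (isCompact_closedBall (0 : Fin m → ℂ) |B|).ultrafilter_le_nhds
      ((hyperfilter ℕ).map fun N => x N (κ N t))
      (le_principal_iff.2 (Ultrafilter.mem_map.2 (univ_mem' hmem)))
    exact ⟨a, ha⟩
  choose a ha using hlim
  have hai : ∀ t i, Tendsto (fun N => x N (κ N t) i) (hyperfilter ℕ) (𝓝 (a t i)) :=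
    fun t i => (tendsto_pi_nhds.1 (ha t)) i
  refine ⟨fun i t => a t i, fun i => ?_, fun t ht => ?_⟩
  · rw [Metric.continuousOn_iff]
    intro t ht ε hε
    obtain ⟨δ, hδ, h⟩ := hequi (ε / (3 * m + 1)) (by positivity)
    have hlt : 3 * m * (ε / (3 * m + 1)) < ε := by
      rw [mul_div_assoc', div_lt_iff₀ (by positivity)]
      nlinarith
    have hle : ∀ u ∈ Set.Icc 0 T, ∀ v ∈ Set.Icc 0 T, u ≤ v → v - u < δ →
        dist (a u i) (a v i) < ε := fun u hu v hv huv huv' =>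
      (le_of_tendsto ((hai u i).dist (hai v i)) (((h u hu v hv huv huv').filter_mono
        Nat.hyperfilter_le_atTop).mono fun N hN => hN i)).trans_lt hlt
    refine ⟨δ, hδ, fun s hs hst => ?_⟩
    rw [Real.dist_eq, abs_lt] at hst
    rcases le_total s t with h1 | h1
    · exact hle s hs t ht h1 (by linarith)
    · rw [dist_comm]
      exact hle t ht s hs h1 (by linarith)
  · refine eq_of_infinite_eval_eq _ _ (hS.mono fun z hz => ?_)
    have hτ : Tendsto (fun N : ℕ => (κ N t : ℝ) / (N + 1)) atTop (𝓝 t) := by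
      have h0 : Tendsto (fun N : ℕ => t - 1 / ((N : ℝ) + 1)) atTop (𝓝 t) := by
        simpa using tendsto_one_div_add_atTop_nhds_zero_nat.const_sub t
      exact tendsto_of_tendsto_of_tendsto_of_le_of_le h0 tendsto_const_nhds
        (fun N => (hκ2 N t).le) (fun N => hκ1 N t ht.1)
    have h1 : Tendsto (fun N : ℕ => (p ((κ N t : ℝ) / (N + 1))).eval z) (hyperfilter ℕ)
        (𝓝 ((p t).eval z)) :=
      (((hc z hz).tendsto t).comp hτ).mono_left Nat.hyperfilter_le_atTop
    have h2 : Tendsto (fun N : ℕ => (p ((κ N t : ℝ) / (N + 1))).eval z) (hyperfilter ℕ)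
        (𝓝 (∏ i, (z - a t i))) := by
      simp only [hx, eval_prod, eval_sub, eval_X, eval_C]
      exact tendsto_finsetProd _ fun i _ => (hai t i).const_sub z
    rw [Set.mem_ofPred_eq, tendsto_nhds_unique h1 h2, eval_prod]
    simp

/-! ### The change of the argument along a path -/

/-- A continuous argument of the path `γ` changes by `Δ` from `a` to `b`. For a path in `ℂ ∖ {0}`,
this determines `Δ`; where `γ` vanishes, the argument is arbitrary. -/
def HasArgChange (γ : ℝ → ℂ) (a b Δ : ℝ) : Prop :=
  ∃ θ : ℝ → ℝ, ContinuousOn θ (Set.Icc a b) ∧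
    (∀ t ∈ Set.Icc a b, γ t = ‖γ t‖ * Complex.exp (θ t * Complex.I)) ∧ θ b - θ a = Δ

namespace HasArgChange

variable {γ γ' : ℝ → ℂ} {a b c Δ Δ' : ℝ}

theorem congr (h : HasArgChange γ a b Δ) (he : ∀ t ∈ Set.Icc a b, γ' t = γ t) :
    HasArgChange γ' a b Δ := by
  obtain ⟨θ, h1, h2, h3⟩ := h
  exact ⟨θ, h1, fun t ht => by rw [he t ht]; exact h2 t ht, h3⟩

theorem const (z : ℂ) (a b : ℝ) : HasArgChange (fun _ => z) a b 0 :=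
  ⟨fun _ => z.arg, continuousOn_const, fun _ _ => (Complex.norm_mul_exp_arg_mul_I z).symm,
    sub_self _⟩

theorem mul (h : HasArgChange γ a b Δ) (h' : HasArgChange γ' a b Δ') :
    HasArgChange (fun t => γ t * γ' t) a b (Δ + Δ') := by
  obtain ⟨θ, h1, h2, h3⟩ := h
  obtain ⟨θ', h1', h2', h3'⟩ := h'
  refine ⟨fun t => θ t + θ' t, h1.add h1', fun t ht => ?_, by rw [← h3, ← h3']; ring⟩
  conv_lhs => simp only []; rw [h2 t ht, h2' t ht]
  push_cast
  rw [norm_mul, add_mul, Complex.exp_add]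
  push_cast
  ring

theorem inv (h : HasArgChange γ a b Δ) : HasArgChange (fun t => (γ t)⁻¹) a b (-Δ) := by
  obtain ⟨θ, h1, h2, h3⟩ := h
  refine ⟨fun t => -θ t, h1.neg, fun t ht => ?_, by rw [← h3]; ring⟩
  conv_lhs => simp only []; rw [h2 t ht]
  push_cast
  rw [norm_inv, neg_mul, Complex.exp_neg, mul_inv]
  push_cast
  rfl

theorem prod {ι : Type*} (s : Finset ι) {f : ι → ℝ → ℂ} {d : ι → ℝ}
    (h : ∀ i ∈ s, HasArgChange (f i) a b (d i)) :
    HasArgChange (fun t => ∏ i ∈ s, f i t) a b (∑ i ∈ s, d i) := by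
  classical
  induction s using Finset.induction_on with
  | empty => simpa using const 1 a b
  | insert i s hi ih =>
    simp only [Finset.prod_insert hi, Finset.sum_insert hi]
    exact (h i (Finset.mem_insert_self i s)).mul
      (ih fun j hj => h j (Finset.mem_insert_of_mem hj))

theorem multiset_prod (s : Multiset ℂ) {f : ℂ → ℝ → ℂ} {d : ℂ → ℝ}
    (h : ∀ i ∈ s, HasArgChange (f i) a b (d i)) :
    HasArgChange (fun t => (s.map fun i => f i t).prod) a b (s.map d).sum := by
  induction s using Multiset.induction_on with
  | empty => simpa using const 1 a b
  | cons i s ih =>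
    simp only [Multiset.map_cons, Multiset.prod_cons, Multiset.sum_cons]
    exact (h i (Multiset.mem_cons_self i s)).mul
      (ih fun j hj => h j (Multiset.mem_cons_of_mem hj))

/-- Two continuous arguments of a path in `ℂ ∖ {0}` differ by a constant. -/
theorem unique (hab : a ≤ b) (h0 : ∀ t ∈ Set.Icc a b, γ t ≠ 0) (h : HasArgChange γ a b Δ)
    (h' : HasArgChange γ a b Δ') : Δ = Δ' := by
  obtain ⟨θ, h1, h2, h3⟩ := h
  obtain ⟨θ', h1', h2', h3'⟩ := h'
  have hpi := Real.two_pi_pos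
  have hint : ∀ t ∈ Set.Icc a b, ∃ n : ℤ, (n : ℝ) = (θ t - θ' t) / (2 * Real.pi) := by
    intro t ht
    have hne : ((‖γ t‖ : ℝ) : ℂ) ≠ 0 := by
      exact_mod_cast norm_ne_zero_iff.2 (h0 t ht)
    have := mul_left_cancel₀ hne ((h2 t ht).symm.trans (h2' t ht))
    obtain ⟨n, hn⟩ := Complex.exp_eq_exp_iff_exists_int.1 this
    refine ⟨n, ?_⟩
    rw [eq_div_iff hpi.ne']
    have := congrArg Complex.im hn
    simp at this
    linarith
  have hconst := isPreconnected_Icc.constant_of_mapsTo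
    (T := Set.range ((↑) : ℤ → ℝ)) (f := fun t => (θ t - θ' t) / (2 * Real.pi))
    Int.isClosedEmbedding_coe_real.isInducing.isDiscrete_range ((h1.sub h1').div_const _) hint
    (Set.left_mem_Icc.2 hab) (Set.right_mem_Icc.2 hab)
  have := (div_left_inj' hpi.ne').1 hconst
  linarith

theorem trans (hab : a ≤ b) (hbc : b ≤ c) (h0 : γ b ≠ 0) (h : HasArgChange γ a b Δ)
    (h' : HasArgChange γ b c Δ') : HasArgChange γ a c (Δ + Δ') := by
  obtain ⟨θ, h1, h2, h3⟩ := h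
  obtain ⟨θ', h1', h2', h3'⟩ := h'
  refine ⟨fun t => θ (min t b) + (θ' (max t b) - θ' b), ?_, fun t ht => ?_, ?_⟩
  · refine (h1.comp (by fun_prop) fun _ ht => ⟨le_min ht.1 hab, min_le_right _ _⟩).add
      ((h1'.comp (by fun_prop) fun _ ht => ⟨le_max_right _ _, max_le ht.2 hbc⟩).sub
        continuousOn_const)
  · rcases le_total t b with htb | htb
    · simpa [min_eq_left htb, max_eq_right htb] using h2 t ⟨ht.1, htb⟩
    · have hne : ((‖γ b‖ : ℝ) : ℂ) ≠ 0 := by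
        exact_mod_cast norm_ne_zero_iff.2 h0
      have h4 := mul_left_cancel₀ hne
        ((h2 b ⟨hab, le_rfl⟩).symm.trans (h2' b ⟨le_rfl, hbc⟩))
      simp only [min_eq_right htb, max_eq_left htb]
      push_cast
      rw [add_mul, sub_mul, Complex.exp_add, Complex.exp_sub, h4, mul_div_cancel₀ _
        (Complex.exp_ne_zero _)]
      exact h2' t ⟨htb, ht.2⟩
  · simp only [min_eq_right hbc, max_eq_left hbc, min_eq_left hab, max_eq_right hab]
    linarith

theorem of_mem_slitPlane (hc : ContinuousOn γ (Set.Icc a b))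
    (hs : ∀ t ∈ Set.Icc a b, γ t ∈ Complex.slitPlane) :
    HasArgChange γ a b ((γ b).arg - (γ a).arg) :=
  ⟨fun t => (γ t).arg, fun _ ht => (Complex.continuousAt_arg (hs _ ht)).comp_continuousWithinAt
    (hc _ ht), fun _ _ => (Complex.norm_mul_exp_arg_mul_I _).symm, rfl⟩

end HasArgChange

/-- A path in `ℂ ∖ {0}` has a continuous argument. -/
theorem exists_continuousOn_arg {γ : ℝ → ℂ} {a b : ℝ} (hab : a ≤ b)
    (hc : ContinuousOn γ (Set.Icc a b)) (h0 : ∀ t ∈ Set.Icc a b, γ t ≠ 0) :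
    ∃ θ : ℝ → ℝ, ContinuousOn θ (Set.Icc a b) ∧
      ∀ t ∈ Set.Icc a b, γ t = ‖γ t‖ * Complex.exp (θ t * Complex.I) := by
  have hcg : Continuous fun t => γ (Set.projIcc a b hab t) :=
    (continuousOn_iff_continuous_domRestrict.1 hc).comp continuous_projIcc
  have hsc : IsSimplyConnected (Set.univ : Set ℝ) := by
    have : ContractibleSpace (Set.univ : Set ℝ) := convex_univ.contractibleSpace ⟨0, trivial⟩
    exact (inferInstance : SimplyConnectedSpace (Set.univ : Set ℝ))
  obtain ⟨f, hf, hfe⟩ := Complex.exists_continuousOn_eqOn_exp_comp (X := ℝ) (U := Set.univ)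
    hsc isOpen_univ (g := fun t => γ (Set.projIcc a b hab t)) hcg.continuousOn
    (by
      rintro ⟨t, -, ht⟩
      exact h0 _ (Set.projIcc a b hab t).2 ht)
  refine ⟨fun t => (f t).im, (Complex.continuous_im.comp_continuousOn hf).mono
    (Set.subset_univ _), fun t ht => ?_⟩
  have h1 : Complex.exp (f t) = γ t := by
    have := hfe (Set.mem_univ t)
    simpa [Set.projIcc_of_mem hab ht] using this
  rw [← h1, Complex.norm_exp]
  push_cast
  rw [← Complex.exp_add, Complex.re_add_im]

/-! ### Encirclements by the Nyquist contour -/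

section Contour

variable {P : Finset ℝ} {R ε : ℝ}

theorem nyquistContour_of_le {t : ℝ} (ht : t ≤ 1) :
    nyquistContour P R ε t = ((∑ ω ∈ P, √(ε ^ 2 - (R * (2 * t - 1) - ω) ^ 2) : ℝ) : ℂ) +
      (R * (2 * t - 1) : ℝ) * Complex.I := if_pos ht

theorem nyquistContour_re_of_le {t : ℝ} (ht : t ≤ 1) :
    (nyquistContour P R ε t).re = ∑ ω ∈ P, √(ε ^ 2 - (R * (2 * t - 1) - ω) ^ 2) := by
  rw [nyquistContour_of_le ht]
  simp only [Complex.add_re, Complex.ofReal_re, Complex.mul_re, Complex.I_re, Complex.I_im,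
    Complex.ofReal_im]
  ring

theorem nyquistContour_im_of_le {t : ℝ} (ht : t ≤ 1) :
    (nyquistContour P R ε t).im = R * (2 * t - 1) := by
  rw [nyquistContour_of_le ht]
  simp only [Complex.add_im, Complex.ofReal_im, Complex.mul_im, Complex.I_re, Complex.I_im,
    Complex.ofReal_re]
  ring

/-- The indentations do not reach the points `± iR`. -/
theorem indentation_eq_zero (hR : ∀ ω ∈ P, |ω| + ε ≤ R) (hε : 0 < ε) {y : ℝ} (hy : |y| = R) :
    ∑ ω ∈ P, √(ε ^ 2 - (y - ω) ^ 2) = 0 := by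
  refine Finset.sum_eq_zero fun ω hω => Real.sqrt_eq_zero_of_nonpos (sub_nonpos.2 ?_)
  rw [sq_le_sq, abs_of_pos hε]
  have := abs_sub_abs_le_abs_sub y ω
  linarith [hR ω hω]

theorem nyquistContour_of_ge (hR : ∀ ω ∈ P, |ω| + ε ≤ R) (hε : 0 < ε) (hR0 : 0 < R) {t : ℝ}
    (ht : 1 ≤ t) : nyquistContour P R ε t =
      R * Complex.exp ((Real.pi * (3 / 2 - t) : ℝ) * Complex.I) := by
  rcases ht.eq_or_lt with rfl | ht
  · rw [nyquistContour_of_le le_rfl, indentation_eq_zero hR hε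
      (by rw [abs_of_pos (by linarith)]; ring),
      show Real.pi * (3 / 2 - 1) = Real.pi / 2 by ring]
    push_cast
    rw [Complex.exp_pi_div_two_mul_I]
    ring
  · exact if_neg (not_le.2 ht)

theorem nyquistContour_zero (hR : ∀ ω ∈ P, |ω| + ε ≤ R) (hε : 0 < ε) (hR0 : 0 < R) :
    nyquistContour P R ε 0 = -(R * Complex.I) := by
  rw [nyquistContour_of_le zero_le_one, indentation_eq_zero hR hε
    (by rw [mul_zero, zero_sub, mul_neg, mul_one, abs_neg, abs_of_pos hR0])]
  push_cast
  ring

theorem nyquistContour_one (hR : ∀ ω ∈ P, |ω| + ε ≤ R) (hε : 0 < ε) (hR0 : 0 < R) :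
    nyquistContour P R ε 1 = R * Complex.I := by
  rw [nyquistContour_of_le le_rfl, indentation_eq_zero hR hε
      (by rw [abs_of_pos (by linarith)]; ring)]
  push_cast
  ring

theorem nyquistContour_two (hR : ∀ ω ∈ P, |ω| + ε ≤ R) (hε : 0 < ε) (hR0 : 0 < R) :
    nyquistContour P R ε 2 = -(R * Complex.I) := by
  rw [nyquistContour_of_ge hR hε hR0 one_le_two,
    show Real.pi * (3 / 2 - 2) = -(Real.pi / 2) by ring]
  push_cast
  rw [← neg_div, Complex.exp_neg_pi_div_two_mul_I]
  ring

theorem continuous_nyquistContour (hR : ∀ ω ∈ P, |ω| + ε ≤ R) (hε : 0 < ε) (hR0 : 0 < R) :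
    Continuous (nyquistContour P R ε) := by
  refine Continuous.if_le (by fun_prop) (by fun_prop) continuous_id continuous_const ?_
  rintro t rfl
  rw [← nyquistContour_of_le le_rfl, nyquistContour_of_ge hR hε hR0 le_rfl]

theorem norm_nyquistContour_of_ge (hR : ∀ ω ∈ P, |ω| + ε ≤ R) (hε : 0 < ε) (hR0 : 0 < R) {t : ℝ}
    (ht : 1 ≤ t) : ‖nyquistContour P R ε t‖ = R := by
  rw [nyquistContour_of_ge hR hε hR0 ht, norm_mul, Complex.norm_exp_ofReal_mul_I, mul_one,
    Complex.norm_real, Real.norm_of_nonneg hR0.le]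

theorem nyquistContour_re_nonneg (hR : ∀ ω ∈ P, |ω| + ε ≤ R) (hε : 0 < ε) (hR0 : 0 < R) {t : ℝ}
    (ht : t ∈ Set.Icc (0 : ℝ) 2) : 0 ≤ (nyquistContour P R ε t).re := by
  rcases le_total t 1 with h | h
  · rw [nyquistContour_re_of_le h]
    exact Finset.sum_nonneg fun _ _ => Real.sqrt_nonneg _
  · rw [nyquistContour_of_ge hR hε hR0 h, Complex.re_ofReal_mul, Complex.exp_ofReal_mul_I_re]
    have := Real.pi_pos
    refine mul_nonneg hR0.le (Real.cos_nonneg_of_mem_Icc ⟨?_, ?_⟩) <;> nlinarith [ht.2]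

theorem nyquistContour_re_le {t : ℝ} (hε : 0 < ε) (ht : t ≤ 1) :
    (nyquistContour P R ε t).re ≤ P.card * ε := by
  rw [nyquistContour_re_of_le ht, ← nsmul_eq_mul]
  refine Finset.sum_le_card_nsmul _ _ _ fun ω _ => ?_
  rw [Real.sqrt_le_left hε.le]
  linarith [sq_nonneg (R * (2 * t - 1) - ω)]

/-- The points left of the Nyquist contour: those in the open left half-plane, and the poles on the
imaginary axis, which the contour bypasses on the right. -/
def LeftOfContour (P : Finset ℝ) (z : ℂ) : Prop := z.re < 0 ∨ z.re = 0 ∧ z.im ∈ P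

/-- The points inside the Nyquist contour; the condition on `ε` keeps them to the right of the
indentations. -/
def InsideContour (P : Finset ℝ) (R ε : ℝ) (z : ℂ) : Prop := P.card * ε < z.re ∧ ‖z‖ < R

theorem nyquistContour_ne_of_left (hR : ∀ ω ∈ P, |ω| + ε ≤ R) (hε : 0 < ε) (hR0 : 0 < R) {z : ℂ}
    (hz : LeftOfContour P z) {t : ℝ} (ht : t ∈ Set.Icc (0 : ℝ) 2) :
    nyquistContour P R ε t ≠ z := by
  rintro rfl
  have h0 := nyquistContour_re_nonneg hR hε hR0 ht
  rcases hz with hz | ⟨hz, him⟩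
  · exact absurd h0 (not_le.2 hz)
  · rcases le_total t 1 with h | h
    · rw [nyquistContour_im_of_le h] at him
      rw [nyquistContour_re_of_le h] at hz
      have := (Finset.sum_eq_zero_iff_of_nonneg fun _ _ => Real.sqrt_nonneg _).1 hz _ him
      rw [sub_self, zero_pow two_ne_zero, sub_zero, Real.sqrt_sq hε.le] at this
      exact hε.ne' this
    · have h1 := norm_nyquistContour_of_ge hR hε hR0 h
      have h2 := Complex.norm_le_abs_re_add_abs_im (nyquistContour P R ε t)
      have h3 := hR _ him
      rw [h1, hz, abs_zero] at h2
      linarith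

theorem nyquistContour_ne_of_inside (hR : ∀ ω ∈ P, |ω| + ε ≤ R) (hε : 0 < ε) (hR0 : 0 < R) {z : ℂ}
    (hz : InsideContour P R ε z) {t : ℝ} : nyquistContour P R ε t ≠ z := by
  rintro rfl
  rcases le_total t 1 with h | h
  · exact absurd hz.1 (not_lt.2 (nyquistContour_re_le hε h))
  · exact absurd hz.2 (norm_nyquistContour_of_ge hR hε hR0 h).not_lt

/-- The contour does not encircle the points to its left, because as seen from there it stays in a
half-plane. -/
theorem hasArgChange_of_left (hR : ∀ ω ∈ P, |ω| + ε ≤ R) (hε : 0 < ε) (hR0 : 0 < R) {z : ℂ}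
    (hz : LeftOfContour P z) : HasArgChange (fun t => nyquistContour P R ε t - z) 0 2 0 := by
  have h := HasArgChange.of_mem_slitPlane (γ := fun t => nyquistContour P R ε t - z) (a := 0)
    (b := 2) (((continuous_nyquistContour hR hε hR0).sub continuous_const).continuousOn)
    (fun t ht => by
      have h0 := nyquistContour_re_nonneg hR hε hR0 ht
      have hne := nyquistContour_ne_of_left hR hε hR0 hz ht
      have hz0 : z.re ≤ 0 := hz.elim le_of_lt fun h => h.1.le
      rw [Complex.mem_slitPlane_iff, Complex.sub_re, Complex.sub_im]
      by_contra! hcon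
      exact hne (Complex.ext (by linarith) (by linarith)))
  simpa only [nyquistContour_zero hR hε hR0, nyquistContour_two hR hε hR0, sub_self] using h

/-- The contour encircles the points inside once clockwise. -/
theorem hasArgChange_of_inside (hR : ∀ ω ∈ P, |ω| + ε ≤ R) (hε : 0 < ε) (hR0 : 0 < R) {z : ℂ}
    (hz : InsideContour P R ε z) :
    HasArgChange (fun t => nyquistContour P R ε t - z) 0 2 (-(2 * Real.pi)) := by
  have hz0 : 0 < z.re := lt_of_le_of_lt (by positivity) hz.1
  -- along the axis, the points of the contour are to the left of `z`
  have h1 : HasArgChange (fun t => nyquistContour P R ε t - z) 0 1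
      (0 + ((z - R * Complex.I).arg - (z + R * Complex.I).arg)) := by
    have h := HasArgChange.of_mem_slitPlane (γ := fun t => z - nyquistContour P R ε t) (a := 0)
      (b := 1) ((continuous_const.sub (continuous_nyquistContour hR hε hR0)).continuousOn)
      (fun t ht => by
        rw [Complex.mem_slitPlane_iff, Complex.sub_re]
        have := nyquistContour_re_le (P := P) (R := R) hε ht.2
        left
        linarith [hz.1])
    simp only [nyquistContour_zero hR hε hR0, nyquistContour_one hR hε hR0, sub_neg_eq_add] at h
    exact ((HasArgChange.const (-1) 0 1).mul h).congr fun t _ => by ring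
  -- along the large semicircle, `1 - z / s` stays in the right half-plane
  have h2 : HasArgChange (fun t => nyquistContour P R ε t - z) 1 2
      (-Real.pi + ((R - z * Complex.I).arg - (R + z * Complex.I).arg)) := by
    let ψ : ℝ → ℂ := fun t => Complex.exp ((Real.pi * (3 / 2 - t) : ℝ) * Complex.I)
    let ψ' : ℝ → ℂ := fun t => Complex.exp ((-(Real.pi * (3 / 2 - t)) : ℝ) * Complex.I)
    have hψ : HasArgChange ψ 1 2 (-Real.pi) := by
      refine ⟨fun t => Real.pi * (3 / 2 - t), by fun_prop, fun t _ => ?_, by ring⟩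
      rw [Complex.norm_exp_ofReal_mul_I, Complex.ofReal_one, one_mul]
    have h := HasArgChange.of_mem_slitPlane (γ := fun t => R - z * ψ' t) (a := 1) (b := 2)
      (by fun_prop) (fun t _ => by
        rw [Complex.mem_slitPlane_iff, Complex.sub_re, Complex.ofReal_re]
        left
        have h3 := Complex.re_le_norm (z * ψ' t)
        rw [norm_mul, Complex.norm_exp_ofReal_mul_I, mul_one] at h3
        linarith [hz.2])
    have e2 : ψ' 2 = Complex.I := by
      simp only [ψ', show -(Real.pi * (3 / 2 - 2)) = Real.pi / 2 by ring]
      push_cast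
      exact Complex.exp_pi_div_two_mul_I
    have e1 : ψ' 1 = -Complex.I := by
      simp only [ψ', show -(Real.pi * (3 / 2 - 1)) = -(Real.pi / 2) by ring]
      push_cast
      rw [← neg_div]
      exact Complex.exp_neg_pi_div_two_mul_I
    simp only [e1, e2, mul_neg, sub_neg_eq_add] at h
    refine (hψ.mul h).congr fun t ht => ?_
    have hinv : ψ t * ψ' t = 1 := by
      simp only [ψ, ψ', ← Complex.exp_add]
      push_cast
      rw [← add_mul, add_neg_cancel, zero_mul, Complex.exp_zero]
    rw [nyquistContour_of_ge hR hε hR0 ht.1]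
    linear_combination z * hinv
  have him : |z.im| < R := (Complex.abs_im_le_norm z).trans_lt hz.2
  have hpi := Real.pi_pos
  have hlow : (z + R * Complex.I).arg = (R - z * Complex.I).arg + Real.pi / 2 := by
    have hre : 0 < (R - z * Complex.I).re := by
      simp only [Complex.sub_re, Complex.ofReal_re, Complex.mul_I_re]
      linarith [neg_abs_le z.im]
    have hne : (R - z * Complex.I) ≠ 0 := fun h => by simp [h] at hre
    have hb := abs_lt.1 (Complex.abs_arg_lt_pi_div_two_iff.2 (Or.inl hre))
    rw [show z + R * Complex.I = (R - z * Complex.I) * Complex.I by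
      linear_combination z * Complex.I_sq, Complex.arg_mul hne Complex.I_ne_zero, Complex.arg_I]
    rw [Complex.arg_I]
    constructor <;> linarith
  have hhigh : (z - R * Complex.I).arg = (R + z * Complex.I).arg - Real.pi / 2 := by
    have hre : 0 < (R + z * Complex.I).re := by
      simp only [Complex.add_re, Complex.ofReal_re, Complex.mul_I_re]
      linarith [le_abs_self z.im]
    have hne : (R + z * Complex.I) ≠ 0 := fun h => by simp [h] at hre
    have hb := abs_lt.1 (Complex.abs_arg_lt_pi_div_two_iff.2 (Or.inl hre))
    rw [show z - R * Complex.I = (R + z * Complex.I) * -Complex.I by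
      linear_combination z * Complex.I_sq, Complex.arg_mul hne (neg_ne_zero.2 Complex.I_ne_zero),
      Complex.arg_neg_I]
    · ring
    rw [Complex.arg_neg_I]
    constructor <;> linarith
  have h3 := h1.trans zero_le_one one_le_two
    (sub_ne_zero.2 (nyquistContour_ne_of_inside hR hε hR0 hz)) h2
  rw [hlow, hhigh] at h3
  convert h3 using 1
  ring

end Contour

/-! ### Minors of rational matrices and the characteristic polynomials -/

/-- The minors of a matrix plus a constant matrix lie in every submodule that contains the minors
of the matrix itself: expand along the constant parts of the rows. -/
theorem det_submatrix_add_map_mem {R A : Type*} [CommRing R] [CommRing A] [Algebra R A] {n : ℕ}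
    (H : Matrix (Fin n) (Fin n) A) (W : Submodule R A) {N : ℕ}
    (hW : ∀ k ≤ N, ∀ e₁ e₂ : Fin k → Fin n, (H.submatrix e₁ e₂).det ∈ W) :
    ∀ k ≤ N, ∀ (e₁ e₂ : Fin k → Fin n) (c : Matrix (Fin k) (Fin k) R),
      (H.submatrix e₁ e₂ + c.map (algebraMap R A)).det ∈ W := by
  intro k
  induction k with
  | zero =>
    intro hk e₁ e₂ c
    have := hW 0 hk e₁ e₂
    rwa [Matrix.det_fin_zero] at this ⊢
  | succ k ih =>
    intro hk e₁ e₂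
    -- induct on the set of rows in which the constant part does not vanish
    suffices h : ∀ (s : Finset (Fin (k + 1))) (c : Matrix (Fin (k + 1)) (Fin (k + 1)) R),
        (∀ i ∉ s, c i = 0) → (H.submatrix e₁ e₂ + c.map (algebraMap R A)).det ∈ W from
      fun c => h Finset.univ c fun i hi => absurd (Finset.mem_univ i) hi
    intro s
    induction s using Finset.induction_on with
    | empty =>
      intro c hc
      have : c = 0 := funext fun i => hc i (Finset.notMem_empty i)
      rw [this, Matrix.map_zero _ (map_zero _), add_zero]
      exact hW _ hk e₁ e₂
    | insert i s _ ihs =>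
      intro c hc
      let M := H.submatrix e₁ e₂ + c.map (algebraMap R A)
      have hM : M = M.updateRow i ((fun j => H (e₁ i) (e₂ j)) + fun j => algebraMap R A (c i j)) :=
        (Matrix.updateRow_eq_self M i).symm
      change M.det ∈ W
      rw [hM, Matrix.det_updateRow_add]
      refine W.add_mem ?_ ?_
      · have : M.updateRow i (fun j => H (e₁ i) (e₂ j)) =
            H.submatrix e₁ e₂ + (c.updateRow i 0).map (algebraMap R A) := by
          ext a b
          by_cases h : a = i
          · subst h; simp
          · simp [h, M]
        rw [this]
        refine ihs _ fun j hj => ?_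
        by_cases h : j = i
        · subst h; simp
        · rw [Matrix.updateRow_ne h]
          exact hc j (by simp [h, hj])
      · rw [Matrix.det_succ_row _ i]
        refine W.sum_mem fun j _ => ?_
        have : (M.updateRow i fun j => algebraMap R A (c i j)).submatrix i.succAbove j.succAbove =
            H.submatrix (e₁ ∘ i.succAbove) (e₂ ∘ j.succAbove) +
              (c.submatrix i.succAbove j.succAbove).map (algebraMap R A) := by
          ext a b
          simp [M, Fin.succAbove_ne]
        rw [this, Matrix.updateRow_self]
        have h := W.smul_mem ((-1) ^ ((i : ℕ) + j) * c i j)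
          (ih (by omega) (e₁ ∘ i.succAbove) (e₂ ∘ j.succAbove)
            (c.submatrix i.succAbove j.succAbove))
        rw [Algebra.smul_def] at h
        simpa using h

section OlCharPoly

variable {n : ℕ} (H : TransferMatrix n)

theorem denom_det_submatrix_dvd_olCharPoly {k : ℕ} (hk : k ≤ n) (e₁ e₂ : Fin k → Fin n) :
    (H.submatrix e₁ e₂).det.denom ∣ olCharPoly H := by
  have h : olCharPoly H ∣ olCharPoly H := dvd_rfl
  conv at h => lhs; rw [olCharPoly]
  rw [Finset.lcm_dvd_iff] at h
  have h1 := h ⟨k, by omega⟩ (Finset.mem_univ _)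
  rw [Finset.lcm_dvd_iff] at h1
  exact h1 (e₁, e₂) (Finset.mem_univ _)

theorem olCharPoly_dvd {q : ℂ[X]}
    (h : ∀ k ≤ n, ∀ e₁ e₂ : Fin k → Fin n, (H.submatrix e₁ e₂).det.denom ∣ q) :
    olCharPoly H ∣ q :=
  Finset.lcm_dvd fun k _ => Finset.lcm_dvd fun e _ => h k (Nat.lt_succ_iff.1 k.2) e.1 e.2

theorem olCharPoly_ne_zero : olCharPoly H ≠ 0 := by
  rw [olCharPoly, Finset.lcm_ne_zero_iff]
  intro k _
  rw [Finset.lcm_ne_zero_iff]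
  exact fun e _ => RatFunc.denom_ne_zero _

theorem denom_apply_dvd_olCharPoly (i j : Fin n) : (H i j).denom ∣ olCharPoly H := by
  have h := denom_det_submatrix_dvd_olCharPoly H (k := 1) (by have := i.2; omega)
    (fun _ => i) (fun _ => j)
  rwa [Matrix.det_fin_one, Matrix.submatrix_apply] at h

end OlCharPoly

theorem denom_dvd_iff {r : RatFunc ℂ} {q : ℂ[X]} (hq : q ≠ 0) :
    r.denom ∣ q ↔ ∃ p, algebraMap ℂ[X] (RatFunc ℂ) p = algebraMap ℂ[X] (RatFunc ℂ) q * r := by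
  have hq' : algebraMap ℂ[X] (RatFunc ℂ) q ≠ 0 := RatFunc.algebraMap_ne_zero hq
  rw [RatFunc.denom_dvd hq]
  refine exists_congr fun p => ?_
  rw [eq_div_iff hq', mul_comm, eq_comm]

/-- The rational functions that become polynomials after multiplication with `q`. -/
def fractionsOver (q : ℂ[X]) : Submodule ℂ[X] (RatFunc ℂ) :=
  (LinearMap.range (Algebra.linearMap ℂ[X] (RatFunc ℂ))).comap
    (LinearMap.mulLeft ℂ[X] (algebraMap ℂ[X] (RatFunc ℂ) q))

theorem one_map_algebraMap_submatrix {R A : Type*} [CommRing R] [CommRing A] [Algebra R A] {n k : ℕ}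
    (e₁ e₂ : Fin k → Fin n) :
    ((1 : Matrix (Fin n) (Fin n) R).submatrix e₁ e₂).map (algebraMap R A) =
      (1 : Matrix (Fin n) (Fin n) A).submatrix e₁ e₂ := by
  rw [← Matrix.submatrix_map, Matrix.map_one _ (map_zero _) (map_one _)]

theorem det_submatrix_one_add_mem {n : ℕ} (H : TransferMatrix n) {k : ℕ} (hk : k ≤ n)
    (e₁ e₂ : Fin k → Fin n) : ((1 + H).submatrix e₁ e₂).det ∈ fractionsOver (olCharPoly H) := by
  have h := det_submatrix_add_map_mem H (fractionsOver (olCharPoly H)) (N := n)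
    (fun k hk e₁ e₂ => (denom_dvd_iff (olCharPoly_ne_zero H)).1
      (denom_det_submatrix_dvd_olCharPoly H hk e₁ e₂)) k hk e₁ e₂
    ((1 : Matrix (Fin n) (Fin n) ℂ[X]).submatrix e₁ e₂)
  rwa [one_map_algebraMap_submatrix, show H.submatrix e₁ e₂ +
    (1 : TransferMatrix n).submatrix e₁ e₂ = (1 + H).submatrix e₁ e₂ from by
      ext; simp [add_comm]] at h

/-- `det (I + H) = φ_cl / φ_ol` -/
theorem algebraMap_clCharPoly {n : ℕ} (H : TransferMatrix n) :
    algebraMap ℂ[X] (RatFunc ℂ) (clCharPoly H) =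
      algebraMap ℂ[X] (RatFunc ℂ) (olCharPoly H) * (1 + H).det := by
  obtain ⟨p, hp⟩ := det_submatrix_one_add_mem H le_rfl id id
  rw [Algebra.linearMap_apply, LinearMap.mulLeft_apply, Matrix.submatrix_id_id] at hp
  rw [clCharPoly, ← hp, RatFunc.num_algebraMap]

/-- The ring of rational functions without a pole at `p`. -/
def regularAt (p : ℂ) : Subring (RatFunc ℂ) where
  carrier := {r | ¬ r.denom.IsRoot p}
  mul_mem' {a b} ha hb h := by
    have := h.dvd (RatFunc.denom_mul_dvd a b)
    rw [root_mul] at this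
    exact this.elim ha hb
  one_mem' := by simp [IsRoot]
  add_mem' {a b} ha hb h := by
    have := h.dvd (RatFunc.denom_add_dvd a b)
    rw [root_mul] at this
    exact this.elim ha hb
  zero_mem' := by simp [IsRoot]
  neg_mem' {a} ha h := by
    have := h.dvd (show (-a).denom ∣ a.denom from
      (RatFunc.denom_dvd (RatFunc.denom_ne_zero a)).2
        ⟨-a.num, by rw [map_neg, neg_div, RatFunc.num_div_denom]⟩)
    exact ha this

theorem mem_regularAt {p : ℂ} {r : RatFunc ℂ} : r ∈ regularAt p ↔ ¬ r.denom.IsRoot p := Iff.rfl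

theorem algebraMap_mem_regularAt (p : ℂ) (q : ℂ[X]) :
    algebraMap ℂ[X] (RatFunc ℂ) q ∈ regularAt p := by
  rw [mem_regularAt, RatFunc.denom_algebraMap]
  simp [IsRoot]

theorem C_mem_regularAt (p a : ℂ) : RatFunc.C a ∈ regularAt p := by
  rw [← RatFunc.algebraMap_C]
  exact algebraMap_mem_regularAt p _

theorem mem_regularAt_of_denom_dvd {p : ℂ} {r : RatFunc ℂ} {q : ℂ[X]} (hd : r.denom ∣ q)
    (hq : ¬ q.IsRoot p) : r ∈ regularAt p := fun h => hq (h.dvd hd)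

/-- If `(X - p) r` is a polynomial and `r` has no pole at `p`, then `p` is a root of that
polynomial. -/
theorem isRoot_of_eq_mul {p : ℂ} {r : RatFunc ℂ} (hr : r ∈ regularAt p) {q : ℂ[X]}
    (h : algebraMap ℂ[X] (RatFunc ℂ) q = algebraMap ℂ[X] (RatFunc ℂ) (X - C p) * r) :
    q.IsRoot p := by
  have hd : algebraMap ℂ[X] (RatFunc ℂ) r.denom ≠ 0 :=
    RatFunc.algebraMap_ne_zero (RatFunc.denom_ne_zero r)
  have h1 : q * r.denom = (X - C p) * r.num := by
    apply RatFunc.algebraMap_injective ℂ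
    rw [map_mul, map_mul, h, mul_assoc]
    congr 1
    nth_rewrite 1 [← RatFunc.num_div_denom r]
    exact div_mul_cancel₀ _ hd
  have h2 := congrArg (eval p) h1
  rw [eval_mul, eval_mul, eval_sub, eval_X, eval_C, sub_self, zero_mul] at h2
  exact (mul_eq_zero.1 h2).resolve_right hr

theorem det_mem_of_forall_mem {A ι : Type*} [CommRing A] [Fintype ι] [DecidableEq ι] (S : Subring A)
    {M : Matrix ι ι A} (h : ∀ i j, M i j ∈ S) : M.det ∈ S := by
  rw [Matrix.det_apply]
  refine S.sum_mem fun σ _ => ?_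
  rw [Units.smul_def]
  exact S.zsmul_mem (S.prod_mem fun i _ => h _ _) _

/-- If the inverse of a matrix has entries in a subring, then the determinant of the matrix divides
all its minors over the subring. -/
theorem exists_det_submatrix_eq_mul {K : Type*} [Field K] {n : ℕ} (S : Subring K)
    {M : Matrix (Fin n) (Fin n) K} (hM : M.det ≠ 0) (hinv : ∀ i j, M⁻¹ i j ∈ S) {k : ℕ}
    (e₁ e₂ : Fin k → Fin n) : ∃ d ∈ S, (M.submatrix e₁ e₂).det = M.det * d := by
  have hu : IsUnit M.det := isUnit_iff_ne_zero.2 hM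
  let P : Matrix (Fin k) (Fin n) K := (1 : Matrix (Fin n) (Fin n) K).submatrix e₁ id
  let Q : Matrix (Fin n) (Fin k) K := (1 : Matrix (Fin n) (Fin n) K).submatrix id e₂
  -- the Schur complement of the upper left block is the submatrix in question
  have hPQ : M.submatrix e₁ e₂ = P * M * Q := by
    ext i j
    simp [P, Q, Matrix.mul_apply, Matrix.one_apply]
  let _ : Invertible M⁻¹ := ⟨M, Matrix.mul_nonsing_inv M hu, Matrix.nonsing_inv_mul M hu⟩
  have hdet := Matrix.det_fromBlocks₁₁ M⁻¹ Q (-P) 0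
  rw [show ⅟(M⁻¹) = M from rfl, zero_sub, Matrix.neg_mul, Matrix.neg_mul, neg_neg, ← hPQ] at hdet
  refine ⟨(Matrix.fromBlocks M⁻¹ Q (-P) 0).det, det_mem_of_forall_mem S ?_, ?_⟩
  · have h1 : ∀ i j, (1 : Matrix (Fin n) (Fin n) K) i j ∈ S := fun i j => by
      rw [Matrix.one_apply]
      split_ifs
      exacts [S.one_mem, S.zero_mem]
    rintro (i | i) (j | j)
    exacts [hinv i j, h1 _ _, S.neg_mem (h1 _ _), S.zero_mem]
  · rw [hdet, ← mul_assoc, Matrix.det_nonsing_inv, Ring.mul_inverse_cancel _ hu, one_mul]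

/-- The entries of `(I + H)⁻¹` have poles only at the roots of `φ_cl`. -/
theorem inv_one_add_mem_regularAt {m : ℕ} {H : TransferMatrix (m + 1)} (hdet : (1 + H).det ≠ 0)
    {p : ℂ} (hp : ¬ (clCharPoly H).IsRoot p) (i j : Fin (m + 1)) :
    (1 + H)⁻¹ i j ∈ regularAt p := by
  refine mem_regularAt_of_denom_dvd ((denom_dvd_iff fun h => hp (by simp [h])).2 ?_) hp
  obtain ⟨q, hq⟩ := det_submatrix_one_add_mem H (Nat.le_succ m) j.succAbove i.succAbove
  rw [Algebra.linearMap_apply, LinearMap.mulLeft_apply] at hq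
  refine ⟨(-1) ^ (j + i : ℕ) * q, ?_⟩
  rw [map_mul, hq, algebraMap_clCharPoly, Matrix.inv_def, Matrix.smul_apply, smul_eq_mul,
    Ring.inverse_eq_inv', Matrix.adjugate_fin_succ_eq_det_submatrix, mul_assoc,
    mul_inv_cancel_left₀ hdet, map_pow, map_neg, map_one]
  ring

/-- If `(I + H)⁻¹` has no pole at `p`, then `p` is not a root of `φ_cl`: otherwise `φ_ol / (X - p)`
would already be a common denominator of the minors of `I + H`, hence of those of `H`. -/
theorem not_isRoot_clCharPoly {n : ℕ} {H : TransferMatrix n} (hdet : (1 + H).det ≠ 0) {p : ℂ}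
    (hS : ∀ i j, (1 + H)⁻¹ i j ∈ regularAt p) : ¬ (clCharPoly H).IsRoot p := by
  intro hp
  obtain ⟨ψc, hψc⟩ := dvd_iff_isRoot.2 hp
  set φ := olCharPoly H
  let ι := algebraMap ℂ[X] (RatFunc ℂ)
  have hXp : ι (X - C p) ≠ 0 := RatFunc.algebraMap_ne_zero (X_sub_C_ne_zero p)
  let a : RatFunc ℂ := ι φ * (ι (X - C p))⁻¹
  let W : Submodule ℂ[X] (RatFunc ℂ) :=
    { carrier := {r | a * r ∈ regularAt p}
      add_mem' := fun {x y} hx hy => by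
        rw [Set.mem_ofPred_eq, mul_add]
        exact (regularAt p).add_mem hx hy
      zero_mem' := by
        rw [Set.mem_ofPred_eq, mul_zero]
        exact (regularAt p).zero_mem
      smul_mem' := fun c x hx => by
        rw [Set.mem_ofPred_eq, Algebra.smul_def, mul_left_comm]
        exact (regularAt p).mul_mem (algebraMap_mem_regularAt p c) hx }
  have hW1 : ∀ k ≤ n, ∀ e₁ e₂ : Fin k → Fin n, ((1 + H).submatrix e₁ e₂).det ∈ W := by
    intro k _ e₁ e₂
    obtain ⟨d, hd, hde⟩ := exists_det_submatrix_eq_mul (regularAt p) hdet hS e₁ e₂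
    change a * _ ∈ regularAt p
    have : a * ((1 + H).submatrix e₁ e₂).det = ι ψc * d := by
      have h1 : ι φ * (1 + H).det = ι (X - C p) * ι ψc := by
        rw [← map_mul, ← hψc]
        exact (algebraMap_clCharPoly H).symm
      have h2 := mul_inv_cancel₀ hXp
      rw [hde]
      linear_combination d * (ι (X - C p))⁻¹ * h1 + d * ι ψc * h2
    rw [this]
    exact (regularAt p).mul_mem (algebraMap_mem_regularAt p ψc) hd
  have hW : ∀ k ≤ n, ∀ e₁ e₂ : Fin k → Fin n, a * (H.submatrix e₁ e₂).det ∈ regularAt p := by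
    intro k hk e₁ e₂
    have h := det_submatrix_add_map_mem (1 + H) W hW1 k hk e₁ e₂
      (-((1 : Matrix (Fin n) (Fin n) ℂ[X]).submatrix e₁ e₂))
    have h2 : (1 + H).submatrix e₁ e₂ +
        (-((1 : Matrix (Fin n) (Fin n) ℂ[X]).submatrix e₁ e₂)).map (algebraMap ℂ[X] (RatFunc ℂ)) =
        H.submatrix e₁ e₂ := by
      have := one_map_algebraMap_submatrix (R := ℂ[X]) (A := RatFunc ℂ) e₁ e₂
      ext i j
      have h3 := congrFun (congrFun this i) j
      simp only [Matrix.map_apply, Matrix.submatrix_apply] at h3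
      simp [h3]
    rw [h2] at h
    exact h
  -- the empty minor shows that `p` is a root of `φ_ol`
  have ha : a ∈ regularAt p := by
    have := hW 0 (Nat.zero_le n) Fin.elim0 Fin.elim0
    rwa [Matrix.det_fin_zero, mul_one] at this
  have hroot : φ.IsRoot p := isRoot_of_eq_mul ha (by
    change ι φ = ι (X - C p) * (ι φ * (ι (X - C p))⁻¹)
    field_simp)
  obtain ⟨ψ, hψ⟩ := dvd_iff_isRoot.2 hroot
  have hφ0 : φ ≠ 0 := olCharPoly_ne_zero H
  have hψ0 : ψ ≠ 0 := by
    rintro rfl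
    exact hφ0 (by rw [hψ, mul_zero])
  have haψ : a = ι ψ := by
    change ι φ * (ι (X - C p))⁻¹ = ι ψ
    rw [hψ, map_mul]
    field_simp
  have hdvd : φ ∣ ψ := by
    refine olCharPoly_dvd H fun k hk e₁ e₂ => (denom_dvd_iff hψ0).2 ?_
    obtain ⟨q, hq⟩ := (denom_dvd_iff hφ0).1 (denom_det_submatrix_dvd_olCharPoly H hk e₁ e₂)
    have hq1 : ι q = ι (X - C p) * (ι ψ * (H.submatrix e₁ e₂).det) := by
      rw [← mul_assoc, ← map_mul, ← hψ]
      exact hq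
    obtain ⟨q', hq'⟩ := dvd_iff_isRoot.2 (isRoot_of_eq_mul (haψ ▸ hW k hk e₁ e₂) hq1)
    refine ⟨q', mul_left_cancel₀ hXp ?_⟩
    rw [← hq1, hq', map_mul]
  have h1 := natDegree_le_of_dvd hdvd hψ0
  rw [hψ, natDegree_mul (X_sub_C_ne_zero p) hψ0, natDegree_X_sub_C] at h1
  omega

/-! ### Values of rational matrices at finite points and at infinity -/

theorem mul_apply_mem {K ι : Type*} [CommRing K] [Fintype ι] (S : Subring K) {A B : Matrix ι ι K}
    (hA : ∀ i j, A i j ∈ S) (hB : ∀ i j, B i j ∈ S) (i j : ι) : (A * B) i j ∈ S := by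
  rw [Matrix.mul_apply]
  exact S.sum_mem fun k _ => S.mul_mem (hA i k) (hB k j)

/-- Determinants commute with a ring homomorphism that is only defined on a subring containing the
entries of the matrix. -/
theorem det_map_of_forall_mem {K R ι : Type*} [CommRing K] [CommRing R] [Fintype ι] [DecidableEq ι]
    {S : Subring K} (f : S →+* R) {F : K → R} (hF : ∀ x : S, f x = F x) {M : Matrix ι ι K}
    (hM : ∀ i j, M i j ∈ S) : (M.map F).det = F M.det := by
  let M' : Matrix ι ι S := fun i j => ⟨M i j, hM i j⟩
  have h1 : M.map F = f.mapMatrix M' := by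
    ext i j
    exact (hF ⟨M i j, hM i j⟩).symm
  have h2 : M = S.subtype.mapMatrix M' := rfl
  rw [h1, ← RingHom.map_det, hF]
  congr 1
  conv_rhs => rw [h2, ← RingHom.map_det]
  rfl

/-- Evaluation at `p` as a ring homomorphism. -/
def evalRegular (p : ℂ) : regularAt p →+* ℂ where
  toFun r := RatFunc.eval (RingHom.id ℂ) p r
  map_one' := RatFunc.eval_one _ _
  map_zero' := RatFunc.eval_zero _ _
  map_add' a b := RatFunc.eval_add _ _ a.2 b.2
  map_mul' a b := RatFunc.eval_mul _ _ a.2 b.2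

theorem det_evalAt {n : ℕ} {H : TransferMatrix n} {p : ℂ} (hH : ∀ i j, H i j ∈ regularAt p) :
    (evalAt H p).det = RatFunc.eval (RingHom.id ℂ) p H.det :=
  det_map_of_forall_mem (evalRegular p) (fun _ => rfl) hH

theorem one_apply_mem {K ι : Type*} [CommRing K] [DecidableEq ι] (S : Subring K)
    (i j : ι) : (1 : Matrix ι ι K) i j ∈ S := by
  rw [Matrix.one_apply]
  split_ifs
  exacts [S.one_mem, S.zero_mem]

theorem apply_mem_regularAt {n : ℕ} {H : TransferMatrix n} {p : ℂ}
    (hp : ¬ (olCharPoly H).IsRoot p) (i j : Fin n) : H i j ∈ regularAt p :=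
  mem_regularAt_of_denom_dvd (denom_apply_dvd_olCharPoly H i j) hp

/-- Away from the open-loop poles, `det (I + H(p)) = φ_cl(p) / φ_ol(p)`. -/
theorem eval_olCharPoly_mul_det {n : ℕ} {H : TransferMatrix n} {p : ℂ}
    (hp : ¬ (olCharPoly H).IsRoot p) :
    (olCharPoly H).eval p * (1 + evalAt H p).det = (clCharPoly H).eval p := by
  have hH := apply_mem_regularAt hp
  have h1H : ∀ i j, (1 + H) i j ∈ regularAt p := fun i j =>
    (regularAt p).add_mem (one_apply_mem _ i j) (hH i j)
  have h1 : 1 + evalAt H p = evalAt (1 + H) p := by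
    ext i j
    have h := RatFunc.eval_add (RingHom.id ℂ) p (one_apply_mem (regularAt p) i j) (hH i j)
    refine Eq.trans ?_ h.symm
    by_cases hij : i = j
    · subst hij; simp [evalAt]
    · simp [evalAt, hij]
  have h2 := congrArg (RatFunc.eval (RingHom.id ℂ) p) (algebraMap_clCharPoly H)
  rw [RatFunc.eval_mul _ _ (algebraMap_mem_regularAt p _) (det_mem_of_forall_mem _ h1H),
    RatFunc.eval_algebraMap, RatFunc.eval_algebraMap] at h2
  rw [h1, det_evalAt h1H]
  simpa using h2.symm

theorem algebraMap_num (r : RatFunc ℂ) : algebraMap ℂ[X] (RatFunc ℂ) r.num =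
    algebraMap ℂ[X] (RatFunc ℂ) r.denom * r := by
  have h := RatFunc.num_div_denom r
  rwa [div_eq_iff (RatFunc.algebraMap_ne_zero (RatFunc.denom_ne_zero r)), mul_comm] at h

/-- Properness and the value at infinity can be read off from any representation as a fraction with
monic denominator. -/
theorem isProper_of_eq {r : RatFunc ℂ} {p q : ℂ[X]} (hq : q.Monic)
    (hpq : p.natDegree ≤ q.natDegree)
    (h : algebraMap ℂ[X] (RatFunc ℂ) q * r = algebraMap ℂ[X] (RatFunc ℂ) p) :
    IsProper r ∧ valueAtInfty r = p.coeff q.natDegree := by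
  have h1 : q * r.num = p * r.denom := by
    apply RatFunc.algebraMap_injective ℂ
    rw [map_mul, map_mul, ← h, mul_assoc]
    rw [algebraMap_num, mul_comm r]
  have hmon := RatFunc.monic_denom r
  have hprop : IsProper r := by
    unfold IsProper
    by_cases h0 : r.num = 0
    · simp [h0]
    · have h2 := congrArg natDegree h1
      have hp0 : p ≠ 0 := by
        rintro rfl
        rw [zero_mul] at h1
        exact (mul_ne_zero hq.ne_zero h0) h1
      rw [natDegree_mul hq.ne_zero h0, natDegree_mul hp0 hmon.ne_zero] at h2
      omega
  refine ⟨hprop, ?_⟩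
  have h2 := congrArg (fun f => f.coeff (q.natDegree + r.denom.natDegree)) h1
  beta_reduce at h2
  rw [coeff_mul_add_eq_of_natDegree_le le_rfl hprop, coeff_mul_add_eq_of_natDegree_le hpq le_rfl,
    hq.coeff_natDegree, hmon.coeff_natDegree, one_mul, mul_one] at h2
  exact h2

theorem isProper_C (a : ℂ) : IsProper (RatFunc.C a) ∧ valueAtInfty (RatFunc.C a) = a := by
  have := isProper_of_eq (r := RatFunc.C a) (p := C a) (q := 1) monic_one (by simp)
    (by rw [map_one, one_mul, RatFunc.algebraMap_C])
  simpa using this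

theorem isProper_add {r s : RatFunc ℂ} (hr : IsProper r) (hs : IsProper s) :
    IsProper (r + s) ∧ valueAtInfty (r + s) = valueAtInfty r + valueAtInfty s := by
  have hmr := RatFunc.monic_denom r
  have hms := RatFunc.monic_denom s
  have hdeg := hmr.natDegree_mul hms
  have h := isProper_of_eq (r := r + s) (p := r.num * s.denom + r.denom * s.num)
    (hmr.mul hms) (by
      rw [hdeg]
      exact natDegree_add_le_of_degree_le (natDegree_mul_le_of_le hr le_rfl)
        (natDegree_mul_le_of_le le_rfl hs))
    (by
      simp only [map_mul, map_add, algebraMap_num]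
      ring)
  rw [hdeg, coeff_add, coeff_mul_add_eq_of_natDegree_le hr le_rfl,
    coeff_mul_add_eq_of_natDegree_le le_rfl hs, hmr.coeff_natDegree, hms.coeff_natDegree, mul_one,
    one_mul] at h
  exact h

theorem isProper_mul {r s : RatFunc ℂ} (hr : IsProper r) (hs : IsProper s) :
    IsProper (r * s) ∧ valueAtInfty (r * s) = valueAtInfty r * valueAtInfty s := by
  have hmr := RatFunc.monic_denom r
  have hms := RatFunc.monic_denom s
  have hdeg := hmr.natDegree_mul hms
  have h := isProper_of_eq (r := r * s) (p := r.num * s.num)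
    (hmr.mul hms) (by
      rw [hdeg]
      exact natDegree_mul_le_of_le hr hs)
    (by
      simp only [map_mul, algebraMap_num]
      ring)
  rw [hdeg, coeff_mul_add_eq_of_natDegree_le hr hs] at h
  exact h

/-- The ring of proper rational functions. -/
def properRing : Subring (RatFunc ℂ) where
  carrier := {r | IsProper r}
  mul_mem' ha hb := (isProper_mul ha hb).1
  one_mem' := by simpa using (isProper_C 1).1
  add_mem' ha hb := (isProper_add ha hb).1
  zero_mem' := by simpa using (isProper_C 0).1
  neg_mem' {a} ha := by
    have := (isProper_mul (isProper_C (-1)).1 ha).1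
    simpa using this

/-- The value at infinity as a ring homomorphism. -/
def valueAtInftyHom : properRing →+* ℂ where
  toFun r := valueAtInfty r
  map_one' := by simpa using (isProper_C 1).2
  map_zero' := by simpa using (isProper_C 0).2
  map_add' a b := (isProper_add a.2 b.2).2
  map_mul' a b := (isProper_mul a.2 b.2).2

section Network

variable {n : ℕ} {L : Matrix (Fin n) (Fin n) ℝ} {g : Fin n → RatFunc ℂ}

theorem loopMatrix_mem_properRing (hg : ∀ i, IsProper (g i)) (i j : Fin n) :
    loopMatrix L g i j ∈ properRing := by
  have hc : ∀ (A : Matrix (Fin n) (Fin n) ℝ) i j, const A i j ∈ properRing := fun A i j =>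
    (isProper_C _).1
  have hd : ∀ i j, Matrix.diagonal g i j ∈ properRing := fun i j => by
    rw [Matrix.diagonal_apply]
    split_ifs
    exacts [hg i, properRing.zero_mem]
  exact mul_apply_mem _ (hc _) (mul_apply_mem _ (mul_apply_mem _ (hc _) hd) (hc _)) i j

theorem det_one_add_loopMatrix_ne_zero (hg : ∀ i, IsProper (g i)) (hwp : WellPosed L g) :
    (1 + loopMatrix L g).det ≠ 0 := by
  intro h0
  apply hwp
  have hH := loopMatrix_mem_properRing (L := L) hg
  have h1H : ∀ i j, (1 + loopMatrix L g) i j ∈ properRing := fun i j =>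
    properRing.add_mem (one_apply_mem _ i j) (hH i j)
  have h := det_map_of_forall_mem valueAtInftyHom (F := valueAtInfty) (fun _ => rfl) h1H
  have h1 : 1 + loopMatrixAtInfty L g = (1 + loopMatrix L g).map valueAtInfty := by
    ext i j
    have := valueAtInftyHom.map_add ⟨_, one_apply_mem properRing i j⟩ ⟨_, hH i j⟩
    refine Eq.trans ?_ this.symm
    rw [Matrix.add_apply]
    congr 1
    by_cases hij : i = j
    · subst hij
      simp only [Matrix.one_apply_eq]
      exact valueAtInftyHom.map_one.symm
    · simp only [Matrix.one_apply_ne hij]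
      exact valueAtInftyHom.map_zero.symm
  rw [h1, h, h0]
  exact valueAtInftyHom.map_zero

end Network

/-! ### The normalized Laplacian -/

namespace IsConnectedLaplacian

variable {n : ℕ} {L : Matrix (Fin n) (Fin n) ℝ}

theorem exists_ne_zero_of_adj (hL : IsConnectedLaplacian L) {i j : Fin n}
    (h : (SimpleGraph.fromRel fun i j => L i j ≠ 0).Adj i j) : i ≠ j ∧ L i j ≠ 0 := by
  rw [SimpleGraph.fromRel_adj] at h
  refine ⟨h.1, h.2.elim id fun h => ?_⟩
  rwa [hL.symm.apply] at h

theorem diag_pos (hL : IsConnectedLaplacian L) (hn : 2 ≤ n) (i : Fin n) : 0 < L i i := by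
  have hnt : Nontrivial (Fin n) := Fin.nontrivial_iff_two_le.2 hn
  obtain ⟨j, hj⟩ := exists_ne i
  obtain ⟨w⟩ := hL.connected.preconnected i j
  cases w with
  | nil => exact absurd rfl hj
  | @cons _ k _ hik _ =>
    obtain ⟨hne, hLik⟩ := hL.exists_ne_zero_of_adj hik
    have h1 := hL.row_sum i
    rw [← Finset.add_sum_erase _ _ (Finset.mem_univ i)] at h1
    have h2 : ∑ j ∈ Finset.univ.erase i, L i j < 0 := by
      refine Finset.sum_neg' (fun j hj => hL.off_diag i j (Finset.ne_of_mem_erase hj).symm)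
        ⟨k, Finset.mem_erase.2 ⟨hne.symm, Finset.mem_univ k⟩,
          lt_of_le_of_ne (hL.off_diag i k hne) hLik⟩
    linarith

theorem sum_mul_sq_sub (hL : IsConnectedLaplacian L) (x : Fin n → ℝ) :
    ∑ i, ∑ j, -L i j * (x i - x j) ^ 2 = 2 * ∑ i, ∑ j, x i * L i j * x j := by
  have h1 : ∑ i, ∑ j, L i j * x i ^ 2 = 0 := by
    refine Finset.sum_eq_zero fun i _ => ?_
    rw [← Finset.sum_mul, hL.row_sum, zero_mul]
  have h2 : ∑ i, ∑ j, L i j * x j ^ 2 = 0 := by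
    rw [Finset.sum_comm]
    refine Finset.sum_eq_zero fun j _ => ?_
    rw [← Finset.sum_mul]
    simp only [fun i => hL.symm.apply j i]
    rw [hL.row_sum, zero_mul]
  have h3 : ∑ i, ∑ j, -L i j * (x i - x j) ^ 2 = 2 * (∑ i, ∑ j, x i * L i j * x j) -
      ∑ i, ∑ j, L i j * x i ^ 2 - ∑ i, ∑ j, L i j * x j ^ 2 := by
    simp only [Finset.mul_sum, ← Finset.sum_sub_distrib]
    refine Finset.sum_congr rfl fun i _ => Finset.sum_congr rfl fun j _ => ?_
    ring
  rw [h3, h1, h2, sub_zero, sub_zero]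

/-- The Laplacian form of a connected graph is positive on non-constant vectors. -/
theorem eq_of_form_nonpos (hL : IsConnectedLaplacian L) {x : Fin n → ℝ}
    (hx : ∑ i, ∑ j, x i * L i j * x j ≤ 0) (i j : Fin n) : x i = x j := by
  have hterm : ∀ i j, 0 ≤ -L i j * (x i - x j) ^ 2 := fun i j => by
    by_cases h : i = j
    · subst h; simp
    · exact mul_nonneg (neg_nonneg.2 (hL.off_diag i j h)) (sq_nonneg _)
  have h0 : ∑ i, ∑ j, -L i j * (x i - x j) ^ 2 = 0 :=
    le_antisymm (by rw [hL.sum_mul_sq_sub]; linarith)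
      (Finset.sum_nonneg fun i _ => Finset.sum_nonneg fun j _ => hterm i j)
  have hz : ∀ i j, -L i j * (x i - x j) ^ 2 = 0 := fun i j =>
    (Finset.sum_eq_zero_iff_of_nonneg fun j _ => hterm i j).1
      ((Finset.sum_eq_zero_iff_of_nonneg fun i _ => Finset.sum_nonneg fun j _ => hterm i j).1 h0 i
        (Finset.mem_univ i)) j (Finset.mem_univ j)
  obtain ⟨w⟩ := hL.connected.preconnected i j
  induction w with
  | nil => rfl
  | cons h _ ih =>
    refine Eq.trans ?_ ih
    have h1 := hL.exists_ne_zero_of_adj h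
    have h2 := (mul_eq_zero.1 (hz _ _)).resolve_left (neg_ne_zero.2 h1.2)
    exact sub_eq_zero.1 (pow_eq_zero_iff two_ne_zero |>.1 h2)

end IsConnectedLaplacian

section Modes

variable {n : ℕ} {L : Matrix (Fin n) (Fin n) ℝ}

theorem normLaplacian_apply (i j : Fin n) :
    normLaplacian L i j = (√(gam L i))⁻¹ * L i j * (√(gam L j))⁻¹ := by
  rw [normLaplacian, invSqrtGam, Matrix.mul_diagonal, Matrix.diagonal_mul]

theorem sqrt_gam_pos (hL : IsConnectedLaplacian L) (hn : 2 ≤ n) (i : Fin n) : 0 < √(gam L i) :=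
  Real.sqrt_pos.2 (mul_pos two_pos (hL.diag_pos hn i))

theorem det_normLaplacian (hL : IsConnectedLaplacian L) (hn : 2 ≤ n) :
    (normLaplacian L).det = 0 := by
  have : L.det = 0 := by
    refine Matrix.exists_mulVec_eq_zero_iff.1 ⟨fun _ => 1, fun h => ?_, ?_⟩
    · exact one_ne_zero (congrFun h ⟨0, by omega⟩)
    · ext i
      simp [Matrix.mulVec, dotProduct, hL.row_sum]
  rw [normLaplacian, Matrix.det_mul, Matrix.det_mul, this, mul_zero, zero_mul]

variable {U : Matrix (Fin n) (Fin n) ℝ} {μ : Fin n → ℝ}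

theorem IsModalDecomposition.eigen_form {A : Matrix (Fin n) (Fin n) ℝ}
    (hU : IsModalDecomposition A U μ) (k : Fin n) : ∑ i, ∑ j, U i k * A i j * U j k = μ k := by
  have h : U.transpose * A * U = Matrix.diagonal μ := by
    have h1 := hU.orthonormal
    conv_lhs => rw [hU.decomp]
    calc U.transpose * (U * Matrix.diagonal μ * U.transpose) * U
        = (U.transpose * U) * Matrix.diagonal μ * (U.transpose * U) := by
          simp only [Matrix.mul_assoc]
      _ = _ := by rw [h1, Matrix.one_mul, Matrix.mul_one]
  have h2 := congrFun (congrFun h k) k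
  rw [Matrix.diagonal_apply_eq, Matrix.mul_apply] at h2
  rw [← h2, Finset.sum_comm]
  refine Finset.sum_congr rfl fun j _ => ?_
  rw [Matrix.mul_apply, Finset.sum_mul]
  rfl

/-- A modal vector of a nonpositive eigenvalue is a multiple of the vector `√γ`. -/
theorem IsModalDecomposition.eq_mul_of_nonpos (hL : IsConnectedLaplacian L) (hn : 2 ≤ n)
    (hU : IsModalDecomposition (normLaplacian L) U μ) {k : Fin n} (hk : μ k ≤ 0) :
    ∃ c : ℝ, ∀ i, U i k = c * √(gam L i) := by
  have hs := fun i => (sqrt_gam_pos hL hn i).ne'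
  let i₀ : Fin n := ⟨0, by omega⟩
  refine ⟨U i₀ k * (√(gam L i₀))⁻¹, fun i => ?_⟩
  have h := hL.eq_of_form_nonpos (x := fun i => U i k * (√(gam L i))⁻¹) (by
    refine le_trans (le_of_eq ?_) hk
    rw [← hU.eigen_form k]
    refine Finset.sum_congr rfl fun i _ => Finset.sum_congr rfl fun j _ => ?_
    rw [normLaplacian_apply]
    ring) i₀ i
  beta_reduce at h
  rw [h, inv_mul_cancel_right₀ (hs i)]

end Modes

section Modes

variable {m : ℕ} {L U : Matrix (Fin (m + 1)) (Fin (m + 1)) ℝ} {μ : Fin (m + 1) → ℝ}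
  {g : Fin (m + 1) → RatFunc ℂ}

/-- Zero is a simple eigenvalue of the normalized Laplacian, and the smallest one. -/
theorem IsModalDecomposition.succ_pos (hL : IsConnectedLaplacian L) (hm : 2 ≤ m + 1)
    (hU : IsModalDecomposition (normLaplacian L) U μ) (i : Fin m) : 0 < μ i.succ := by
  by_contra! hle
  obtain ⟨c, hc⟩ := hU.eq_mul_of_nonpos hL hm hle
  obtain ⟨c', hc'⟩ := hU.eq_mul_of_nonpos hL hm ((hU.ascending (Fin.zero_le i.succ)).trans hle)
  have horth : ∀ j k, ∑ l, U l j * U l k = (1 : Matrix (Fin (m + 1)) (Fin (m + 1)) ℝ) j k := by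
    intro j k
    rw [← hU.orthonormal, Matrix.mul_apply]
    rfl
  have h1 := horth i.succ i.succ
  have h2 := horth 0 0
  have h3 := horth 0 i.succ
  rw [Matrix.one_apply_eq] at h1 h2
  rw [Matrix.one_apply_ne (Fin.succ_ne_zero i).symm] at h3
  have hfac : ∀ a b : ℝ, ∑ l, a * √(gam L l) * (b * √(gam L l)) = a * b * ∑ l, √(gam L l) ^ 2 := by
    intro a b
    rw [Finset.mul_sum]
    exact Finset.sum_congr rfl fun l _ => by ring
  simp only [hc, hc', hfac] at h1 h2 h3
  -- the Gram determinant of two parallel vectors vanishes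
  have h4 : (c' * c * ∑ l, √(gam L l) ^ 2) ^ 2 = 1 := by
    linear_combination (c' * c' * ∑ l, √(gam L l) ^ 2) * h1 + h2
  rw [h3] at h4
  norm_num at h4

theorem IsModalDecomposition.zero_eq (hL : IsConnectedLaplacian L) (hm : 2 ≤ m + 1)
    (hU : IsModalDecomposition (normLaplacian L) U μ) : μ 0 = 0 := by
  have h := det_normLaplacian hL hm
  rw [hU.decomp, Matrix.det_mul, Matrix.det_mul, Matrix.det_diagonal, mul_right_comm,
    ← Matrix.det_mul, mul_eq_one_comm.1 hU.orthonormal, Matrix.det_one, one_mul, Fin.prod_univ_succ]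
    at h
  exact (mul_eq_zero.1 h).resolve_right
    (Finset.prod_ne_zero_iff.2 fun i _ => (hU.succ_pos hL hm i).ne')

/-- `const` is a ring homomorphism. -/
theorem const_eq_mapMatrix {n : ℕ} (A : Matrix (Fin n) (Fin n) ℝ) :
    const A = (RatFunc.C.comp Complex.ofRealHom).mapMatrix A := rfl

theorem const_mul {n : ℕ} (A B : Matrix (Fin n) (Fin n) ℝ) :
    const (A * B) = const A * const B := by
  simp only [const_eq_mapMatrix, map_mul]

theorem const_one {n : ℕ} : const (1 : Matrix (Fin n) (Fin n) ℝ) = 1 := by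
  simp only [const_eq_mapMatrix, map_one]

theorem const_mem_regularAt {n : ℕ} (A : Matrix (Fin n) (Fin n) ℝ) (p : ℂ) (i j : Fin n) :
    const A i j ∈ regularAt p := C_mem_regularAt p _

/-- `L' T = I - (I + L' G')⁻¹` for the closed-loop transfer matrix `T`. -/
theorem const_mul_closedLoop {n : ℕ} {L : Matrix (Fin n) (Fin n) ℝ} {g : Fin n → RatFunc ℂ}
    (hdet : (1 + loopMatrix L g).det ≠ 0) :
    const (normLaplacian L) * closedLoop L g = 1 - (1 + loopMatrix L g)⁻¹ := by
  have hu : IsUnit (1 + loopMatrix L g).det := isUnit_iff_ne_zero.2 hdet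
  unfold closedLoop
  unfold loopMatrix at hu ⊢
  set A := const (normLaplacian L)
  set G := normAgents L g
  have hu' : IsUnit (1 + G * A).det := by rwa [Matrix.det_one_add_mul_comm]
  have h1 : (1 + A * G) * (A * (1 + G * A)⁻¹) = A := by
    rw [← Matrix.mul_assoc, show (1 + A * G) * A = A * (1 + G * A) by
      rw [Matrix.add_mul, Matrix.mul_add, Matrix.one_mul, Matrix.mul_one, Matrix.mul_assoc],
      Matrix.mul_assoc, Matrix.mul_nonsing_inv _ hu', Matrix.mul_one]
  have h2 : A * (1 + G * A)⁻¹ = (1 + A * G)⁻¹ * A := by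
    have h3 := congrArg ((1 + A * G)⁻¹ * ·) h1
    beta_reduce at h3
    rwa [← Matrix.mul_assoc, Matrix.nonsing_inv_mul _ hu, Matrix.one_mul] at h3
  rw [← Matrix.mul_assoc, h2, Matrix.mul_assoc, eq_sub_iff_add_eq]
  conv_lhs => rw [add_comm, ← Matrix.mul_one (1 + A * G)⁻¹, Matrix.mul_assoc, ← Matrix.mul_add,
    Matrix.one_mul]
  exact Matrix.nonsing_inv_mul _ hu

/-- In modal coordinates, `1 - (I + L' G')⁻¹` is the closed-loop transfer matrix with its rows
multiplied by the eigenvalues `μ_i`. The average mode drops out because of `μ_1 = 0`, so exactly the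
interarea modes matter. -/
theorem asymptoticSync_iff (hL : IsConnectedLaplacian L) (hm : 2 ≤ m + 1)
    (hU : IsModalDecomposition (normLaplacian L) U μ) (hdet : (1 + loopMatrix L g).det ≠ 0) :
    AsymptoticSync L g U ↔
      ∀ p : ℂ, 0 ≤ p.re → ∀ i j, (1 + loopMatrix L g)⁻¹ i j ∈ regularAt p := by
  set S := (1 + loopMatrix L g)⁻¹ with hS
  set V := const U.transpose * closedLoop L g with hV
  have hUU : const U.transpose * const U = 1 := by
    rw [← const_mul, hU.orthonormal, const_one]
  have h1 : const U * (const (Matrix.diagonal μ) * V) = 1 - S := by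
    rw [hS, ← const_mul_closedLoop hdet, hV, ← Matrix.mul_assoc, ← Matrix.mul_assoc, ← const_mul,
      ← const_mul, ← hU.decomp]
  have h2 : const (Matrix.diagonal μ) * V = const U.transpose * (1 - S) := by
    rw [← h1, ← Matrix.mul_assoc (const U.transpose), hUU, Matrix.one_mul]
  have h3 : ∀ i j, (const (Matrix.diagonal μ) * V) i j = RatFunc.C (μ i : ℂ) * V i j := by
    intro i j
    have : const (Matrix.diagonal μ) = Matrix.diagonal fun i => RatFunc.C (μ i : ℂ) := by
      rw [const, Matrix.diagonal_map]
      rw [Complex.ofReal_zero, map_zero]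
    rw [this, Matrix.diagonal_mul]
  constructor
  · intro h p hp i j
    have hV' : ∀ i j, (const (Matrix.diagonal μ) * V) i j ∈ regularAt p := by
      intro i j
      rw [h3]
      refine Fin.cases ?_ (fun i => ?_) i
      · rw [hU.zero_eq hL hm, Complex.ofReal_zero, map_zero, zero_mul]
        exact (regularAt p).zero_mem
      · exact (regularAt p).mul_mem (C_mem_regularAt p _) (h i j p hp)
    have h4 : S = 1 - const U * (const (Matrix.diagonal μ) * V) := by rw [h1, sub_sub_cancel]
    rw [h4]
    exact (regularAt p).sub_mem (one_apply_mem _ i j)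
      (mul_apply_mem _ (const_mem_regularAt U p) hV' i j)
  · intro h i j p hp
    have h4 : RatFunc.C (μ i.succ : ℂ) * V i.succ j ∈ regularAt p := by
      rw [← h3, h2]
      exact mul_apply_mem _ (const_mem_regularAt _ p) (fun i j => (regularAt p).sub_mem
        (one_apply_mem _ i j) (h p hp i j)) _ _
    have hμ : (μ i.succ : ℂ) ≠ 0 := Complex.ofReal_ne_zero.2 (hU.succ_pos hL hm i).ne'
    have h5 := (regularAt p).mul_mem (C_mem_regularAt p (μ i.succ : ℂ)⁻¹) h4
    rwa [← mul_assoc, ← map_mul, inv_mul_cancel₀ hμ, map_one, one_mul] at h5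

/-- The interarea modes are stable if and only if the closed-loop characteristic polynomial has no
root in the closed right half-plane. -/
theorem asymptoticSync_iff_clCharPoly (hL : IsConnectedLaplacian L) (hm : 2 ≤ m + 1)
    (hU : IsModalDecomposition (normLaplacian L) U μ) (hdet : (1 + loopMatrix L g).det ≠ 0) :
    AsymptoticSync L g U ↔ ∀ p : ℂ, 0 ≤ p.re → ¬ (clCharPoly (loopMatrix L g)).IsRoot p := by
  rw [asymptoticSync_iff hL hm hU hdet]
  exact forall₂_congr fun p _ => ⟨not_isRoot_clCharPoly hdet, inv_one_add_mem_regularAt hdet⟩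

end Modes

/-! ### Existence of eigenloci -/

theorem divX_mul_X_of_coeff_zero {R : Type*} [CommRing R] {p : R[X]} (h : p.coeff 0 = 0) :
    p.divX * X = p := by
  conv_rhs => rw [← divX_mul_X_add p, h, map_zero, add_zero]

theorem norm_le_of_isRoot_charpoly {n : ℕ} {A : Matrix (Fin n) (Fin n) ℂ} {K : ℝ}
    (hA : ∀ i j, ‖A i j‖ ≤ K) {z : ℂ} (hz : A.charpoly.IsRoot z) : ‖z‖ ≤ n * K := by
  rw [IsRoot, Matrix.eval_charpoly] at hz
  obtain ⟨v, hv0, hv⟩ := Matrix.exists_mulVec_eq_zero_iff.2 hz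
  rw [Matrix.sub_mulVec, sub_eq_zero] at hv
  have h1 : z • v = A.mulVec v := by
    rw [← hv]
    ext i
    simp [Matrix.mulVec_diagonal]
  rcases n.eq_zero_or_pos with rfl | hn
  · exact absurd (Subsingleton.elim _ _) hv0
  have hK : 0 ≤ K := (norm_nonneg _).trans (hA ⟨0, hn⟩ ⟨0, hn⟩)
  have h2 : ‖z • v‖ ≤ n * K * ‖v‖ := by
    rw [h1, pi_norm_le_iff_of_nonneg (by positivity)]
    intro i
    calc ‖∑ j, A i j * v j‖ ≤ ∑ j, ‖A i j * v j‖ := norm_sum_le _ _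
      _ ≤ ∑ _j : Fin n, K * ‖v‖ := Finset.sum_le_sum fun j _ => by
          rw [norm_mul]
          exact mul_le_mul (hA i j) (norm_le_pi_norm v j) (norm_nonneg _) hK
      _ = n * K * ‖v‖ := by
          rw [Finset.sum_const, Finset.card_univ, Fintype.card_fin, nsmul_eq_mul, mul_assoc]
  rw [norm_smul] at h2
  exact le_of_mul_le_mul_right h2 (norm_pos_iff.2 hv0)

/-- The eigenvalues of a continuous path of singular matrices form continuous branches, the first of
which vanishes. -/
theorem exists_continuousOn_eigenvalues {m : ℕ} {T : ℝ} (hT : 0 ≤ T)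
    {A : ℝ → Matrix (Fin (m + 1)) (Fin (m + 1)) ℂ} (hA : ContinuousOn A (Set.Icc 0 T))
    (hdet : ∀ t ∈ Set.Icc 0 T, (A t).det = 0) :
    ∃ l : Fin (m + 1) → ℝ → ℂ, (∀ i, ContinuousOn (l i) (Set.Icc 0 T)) ∧
      (∀ t ∈ Set.Icc 0 T, l 0 t = 0) ∧
      ∀ t ∈ Set.Icc 0 T, (A t).charpoly = ∏ i, (X - C (l i t)) := by
  let A' : ℝ → Matrix (Fin (m + 1)) (Fin (m + 1)) ℂ := fun t => A (Set.projIcc 0 T hT t)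
  have hA' : Continuous A' :=
    (continuousOn_iff_continuous_domRestrict.1 hA).comp continuous_projIcc
  have hAij : ∀ i j, Continuous fun t => A' t i j := fun i j =>
    (continuous_apply j).comp ((continuous_apply i).comp hA')
  obtain ⟨K, hK⟩ := isCompact_Icc.exists_bound_of_continuousOn (s := Set.Icc 0 T)
    (f := fun t => ∑ i, ∑ j, ‖A' t i j‖)
    (continuous_finsetSum _ fun i _ =>
      continuous_finsetSum _ fun j _ => (hAij i j).norm).continuousOn
  have hproj : ∀ t ∈ Set.Icc 0 T, A' t = A t := fun t ht => by
    simp only [A', Set.projIcc_of_mem hT ht]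
  have hidem : ∀ t, A' (Set.projIcc 0 T hT t) = A' t := fun t => hproj _ (Set.projIcc 0 T hT t).2
  have hbound : ∀ t i j, ‖A' t i j‖ ≤ K := by
    intro t i j
    rw [← hidem t]
    refine le_trans ?_ ((le_abs_self _).trans (hK _ (Set.projIcc 0 T hT t).2))
    exact (Finset.single_le_sum (f := fun j => ‖A' (Set.projIcc 0 T hT t) i j‖)
      (fun _ _ => norm_nonneg _) (Finset.mem_univ j)).trans
      (Finset.single_le_sum (f := fun i => ∑ j, ‖A' (Set.projIcc 0 T hT t) i j‖)
        (fun _ _ => Finset.sum_nonneg fun _ _ => norm_nonneg _) (Finset.mem_univ i))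
  have hX : ∀ t, (A' t).charpoly.divX * X = (A' t).charpoly := fun t => by
    refine divX_mul_X_of_coeff_zero ?_
    have h := Matrix.det_eq_sign_charpoly_coeff (A' t)
    rw [hdet _ (Set.projIcc 0 T hT t).2] at h
    exact (mul_eq_zero.1 h.symm).resolve_left (pow_ne_zero _ (neg_ne_zero.2 one_ne_zero))
  obtain ⟨l, hl1, hl2⟩ := exists_continuousOn_roots (m := m) (p := fun t => (A' t).charpoly.divX)
    (fun t => Monic.of_mul_monic_right monic_X (by
      rw [hX]
      exact Matrix.charpoly_monic _))
    (fun t => by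
      rw [natDegree_divX_eq_natDegree_tsub_one, Matrix.charpoly_natDegree_eq_dim, Fintype.card_fin]
      rfl)
    (S := {0}ᶜ) (Set.finite_singleton 0).infinite_compl
    (fun x hx => by
      have h : ∀ t, (A' t).charpoly.divX.eval x =
          (Matrix.scalar (Fin (m + 1)) x - A' t).det / x := fun t => by
        rw [← Matrix.eval_charpoly, ← hX t, eval_mul, eval_X, mul_div_cancel_right₀ _ hx, hX t]
      simp only [h]
      exact ((continuous_const.sub hA').matrix_det).div_const x)
    (B := (m + 1 : ℕ) * K) (fun t z hz => norm_le_of_isRoot_charpoly (hbound t) (by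
      rw [← hX t]
      exact root_mul.2 (Or.inl hz))) T
  refine ⟨Fin.cons (fun _ => 0) l, fun i => ?_, fun t _ => rfl, fun t ht => ?_⟩
  · refine Fin.cases ?_ (fun i => ?_) i
    · exact continuousOn_const
    · exact hl1 i
  · rw [← hproj t ht, ← hX t, hl2 t ht, Fin.prod_univ_succ, mul_comm]
    simp

/-! ### Counting roots with the Nyquist contour -/

/-- The contour with indentations at `P` and radii `R`, `ε` is adapted to the polynomial `q`: it
encloses exactly the roots of `q` in the open right half-plane, and the indentations do not reach
the roots on the imaginary axis other than their centres. -/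
structure IsAdapted (q : ℂ[X]) (P : Finset ℝ) (R ε : ℝ) : Prop where
  eps_pos : 0 < ε
  radius_pos : 0 < R
  indent : ∀ ω ∈ P, |ω| + ε ≤ R
  norm_lt : ∀ z, q.IsRoot z → ‖z‖ < R
  lt_re : ∀ z, q.IsRoot z → 0 < z.re → P.card * ε < z.re
  axis : ∀ z, q.IsRoot z → ∀ ω ∈ P, z.im ≠ ω → ε ≤ |z.im - ω|

theorem exists_isAdapted {q : ℂ[X]} (hq : q ≠ 0) (P : Finset ℝ) :
    ∃ R₀ > (0 : ℝ), ∃ ε₀ > (0 : ℝ), ∀ R > R₀, ∀ ε : ℝ, 0 < ε → ε < ε₀ → IsAdapted q P R ε := by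
  have hroot : ∀ z, q.IsRoot z → z ∈ q.roots.toFinset := fun z hz =>
    Multiset.mem_toFinset.2 ((mem_roots hq).2 hz)
  have hR : ∀ᶠ R : ℝ in atTop, 0 < R ∧ (∀ ω ∈ P, |ω| + 1 ≤ R) ∧ ∀ z ∈ q.roots.toFinset, ‖z‖ < R :=
    (eventually_gt_atTop 0).and (((Finset.eventually_all P).2 fun ω _ => eventually_ge_atTop _).and
      ((Finset.eventually_all _).2 fun z _ => eventually_gt_atTop _))
  have hlim : Tendsto (fun ε : ℝ => P.card * ε) (𝓝[>] 0) (𝓝 0) := by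
    have h : Tendsto (fun ε : ℝ => P.card * ε) (𝓝 0) (𝓝 (P.card * 0)) :=
      tendsto_id.const_mul _
    rw [mul_zero] at h
    exact h.mono_left nhdsWithin_le_nhds
  have hε : ∀ᶠ ε : ℝ in 𝓝[>] 0, ε ≤ 1 ∧ (∀ z ∈ q.roots.toFinset, 0 < z.re → P.card * ε < z.re) ∧
      ∀ z ∈ q.roots.toFinset, ∀ ω ∈ P, z.im ≠ ω → ε ≤ |z.im - ω| := by
    have hsmall : ∀ a > (0 : ℝ), ∀ᶠ ε : ℝ in 𝓝[>] 0, ε ≤ a := fun a ha =>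
      (eventually_le_nhds ha).filter_mono nhdsWithin_le_nhds
    refine (hsmall 1 one_pos).and (((Finset.eventually_all _).2 fun z _ => ?_).and
      ((Finset.eventually_all _).2 fun z _ => (Finset.eventually_all _).2 fun ω _ => ?_))
    · by_cases hz : 0 < z.re
      · exact (hlim.eventually (gt_mem_nhds hz)).mono fun ε h _ => h
      · exact Eventually.of_forall fun ε h => absurd h hz
    · by_cases hz : z.im = ω
      · exact Eventually.of_forall fun ε h => absurd hz h
      · exact (hsmall _ (abs_pos.2 (sub_ne_zero.2 hz))).mono fun ε h _ => h
  obtain ⟨R₀, hR₀⟩ := eventually_atTop.1 hR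
  obtain ⟨ε₀, hε₀, hsub⟩ := mem_nhdsGT_iff_exists_Ioo_subset.1 hε
  refine ⟨max R₀ 1, by positivity, ε₀, hε₀, fun R hRR ε h1 h2 => ?_⟩
  obtain ⟨hR1, hR2, hR3⟩ := hR₀ R ((le_max_left _ _).trans hRR.le)
  obtain ⟨he1, he2, he3⟩ := hsub ⟨h1, h2⟩
  exact ⟨h1, hR1, fun ω hω => by linarith [hR2 ω hω], fun z hz => hR3 z (hroot z hz),
    fun z hz => he2 z (hroot z hz), fun z hz => he3 z (hroot z hz)⟩

namespace IsAdapted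

variable {q f : ℂ[X]} {P : Finset ℝ} {R ε : ℝ}

theorem left_or_inside (h : IsAdapted q P R ε) {z : ℂ} (hz : q.IsRoot z)
    (haxis : z.re = 0 → z.im ∈ P) : LeftOfContour P z ∨ 0 < z.re ∧ InsideContour P R ε z := by
  rcases lt_trichotomy z.re 0 with h0 | h0 | h0
  · exact Or.inl (Or.inl h0)
  · exact Or.inl (Or.inr ⟨h0, haxis h0⟩)
  · exact Or.inr ⟨h0, h.lt_re z hz h0, h.norm_lt z hz⟩

theorem continuous_nyquistContour (h : IsAdapted q P R ε) : Continuous (nyquistContour P R ε) :=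
  NetworkSync.continuous_nyquistContour h.indent h.eps_pos h.radius_pos

theorem nyquistContour_ne (h : IsAdapted q P R ε) {z : ℂ} (hz : q.IsRoot z)
    (haxis : z.re = 0 → z.im ∈ P) {t : ℝ} (ht : t ∈ Set.Icc (0 : ℝ) 2) :
    nyquistContour P R ε t ≠ z := by
  rcases h.left_or_inside hz haxis with h1 | ⟨_, h1⟩
  · exact nyquistContour_ne_of_left h.indent h.eps_pos h.radius_pos h1 ht
  · exact nyquistContour_ne_of_inside h.indent h.eps_pos h.radius_pos h1

theorem eval_nyquistContour_ne_zero (h : IsAdapted q P R ε) (hfq : f ∣ q)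
    (haxis : ∀ z, f.IsRoot z → z.re = 0 → z.im ∈ P) {t : ℝ} (ht : t ∈ Set.Icc (0 : ℝ) 2) :
    f.eval (nyquistContour P R ε t) ≠ 0 := fun h0 =>
  h.nyquistContour_ne (IsRoot.dvd h0 hfq) (haxis _ h0) ht rfl

open Classical in
/-- The argument principle for polynomials: along the contour, the argument of `f` decreases by `2π`
for every root of `f` in the open right half-plane. -/
theorem hasArgChange_eval (h : IsAdapted q P R ε) (hfq : f ∣ q) (hf : f ≠ 0)
    (haxis : ∀ z, f.IsRoot z → z.re = 0 → z.im ∈ P) :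
    HasArgChange (fun t => f.eval (nyquistContour P R ε t)) 0 2
      (-(2 * Real.pi) * (f.roots.filter fun p => 0 < p.re).card) := by
  have hroots := HasArgChange.multiset_prod (a := 0) (b := 2) f.roots
    (f := fun z t => nyquistContour P R ε t - z)
    (d := fun z => if 0 < z.re then -(2 * Real.pi) else 0) (fun z hz => by
      have hz' := (mem_roots hf).1 hz
      rcases h.left_or_inside (hz'.dvd hfq) (haxis z hz') with h1 | ⟨h0, h1⟩
      · rw [if_neg (not_lt.2 (h1.elim le_of_lt fun h => h.1.le))]
        exact hasArgChange_of_left h.indent h.eps_pos h.radius_pos h1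
      · rw [if_pos h0]
        exact hasArgChange_of_inside h.indent h.eps_pos h.radius_pos h1)
  have hsum : ∀ s : Multiset ℂ, (s.map fun z => if 0 < z.re then -(2 * Real.pi) else 0).sum =
      -(2 * Real.pi) * (s.filter fun p => 0 < p.re).card := by
    intro s
    induction s using Multiset.induction_on with
    | empty => simp
    | cons z s ih =>
      rw [Multiset.map_cons, Multiset.sum_cons, ih]
      by_cases hz : 0 < z.re
      · rw [Multiset.filter_cons_of_pos (p := fun p : ℂ => 0 < p.re) _ hz, Multiset.card_cons,
          if_pos hz]
        push_cast
        ring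
      · rw [Multiset.filter_cons_of_neg (p := fun p : ℂ => 0 < p.re) _ hz, if_neg hz, zero_add]
  rw [hsum] at hroots
  have := (HasArgChange.const f.leadingCoeff 0 2).mul hroots
  rw [zero_add] at this
  refine this.congr fun t _ => ?_
  exact (IsAlgClosed.splits f).eval_eq_prod_roots _

/-- A root of `q` on the imaginary axis that is not bypassed lies on the contour. -/
theorem exists_nyquistContour_eq (h : IsAdapted q P R ε) {z : ℂ} (hz : q.IsRoot z)
    (hre : z.re = 0) (him : z.im ∉ P) :
    ∃ t ∈ Set.Icc (0 : ℝ) 2, nyquistContour P R ε t = z := by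
  have hR := h.radius_pos
  have habs := abs_le.1 ((Complex.abs_im_le_norm z).trans (h.norm_lt z hz).le)
  have hy : R * (2 * ((z.im / R + 1) / 2) - 1) = z.im := by field_simp; ring
  have h1 : z.im / R ≤ 1 := (div_le_one hR).2 habs.2
  have h2 : -1 ≤ z.im / R := by rw [le_div_iff₀ hR]; linarith [habs.1]
  have ht : (z.im / R + 1) / 2 ≤ 1 := by linarith
  refine ⟨(z.im / R + 1) / 2, ⟨by linarith, by linarith⟩, Complex.ext ?_ ?_⟩
  · rw [nyquistContour_re_of_le ht, hre, hy]
    refine Finset.sum_eq_zero fun ω hω => Real.sqrt_eq_zero_of_nonpos (sub_nonpos.2 ?_)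
    rw [sq_le_sq, abs_of_pos h.eps_pos]
    exact h.axis z hz ω hω fun h => him (h ▸ hω)
  · rw [nyquistContour_im_of_le ht, hy]

end IsAdapted

/-! ### The generalized Nyquist criterion for the eigenloci -/

theorem clCharPoly_ne_zero {n : ℕ} {H : TransferMatrix n} (hdet : (1 + H).det ≠ 0) :
    clCharPoly H ≠ 0 := fun h0 => by
  have := algebraMap_clCharPoly H
  rw [h0, map_zero] at this
  exact mul_ne_zero (RatFunc.algebraMap_ne_zero (olCharPoly_ne_zero H)) hdet this.symm

theorem mem_axisPoles {n : ℕ} {H : TransferMatrix n} {z : ℂ} (hz : (olCharPoly H).IsRoot z)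
    (hre : z.re = 0) : z.im ∈ axisPoles H := by
  classical
  refine Finset.mem_image.2 ⟨z, Finset.mem_filter.2 ⟨Multiset.mem_toFinset.2 ?_, hre⟩, rfl⟩
  exact (mem_roots (olCharPoly_ne_zero H)).2 hz

theorem isRoot_of_mem_axisPoles {n : ℕ} {H : TransferMatrix n} {z : ℂ} (hre : z.re = 0)
    (him : z.im ∈ axisPoles H) : (olCharPoly H).IsRoot z := by
  classical
  obtain ⟨p, hp, hpz⟩ := Finset.mem_image.1 him
  obtain ⟨hp1, hp2⟩ := Finset.mem_filter.1 hp
  have hpz' : p = z := Complex.ext (hp2.trans hre.symm) hpz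
  exact hpz' ▸ (mem_roots (olCharPoly_ne_zero H)).1 (Multiset.mem_toFinset.1 hp1)

theorem det_loopMatrix {n : ℕ} {L : Matrix (Fin n) (Fin n) ℝ} (hL : IsConnectedLaplacian L)
    (hn : 2 ≤ n) (g : Fin n → RatFunc ℂ) : (loopMatrix L g).det = 0 := by
  rw [loopMatrix, Matrix.det_mul, const_eq_mapMatrix, ← RingHom.map_det, det_normLaplacian hL hn,
    map_zero, zero_mul]

theorem continuousOn_evalAt {n : ℕ} {H : TransferMatrix n} {c : ℝ → ℂ} (hc : Continuous c)
    {s : Set ℝ} (hs : ∀ t ∈ s, ¬ (olCharPoly H).IsRoot (c t)) :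
    ContinuousOn (fun t => evalAt H (c t)) s := by
  refine continuousOn_pi.2 fun i => continuousOn_pi.2 fun j => ?_
  have h : ∀ t, evalAt H (c t) i j = (H i j).num.eval (c t) / (H i j).denom.eval (c t) :=
    fun t => rfl
  simp only [h]
  exact ((H i j).num.continuous.comp hc).continuousOn.div
    ((H i j).denom.continuous.comp hc).continuousOn fun t ht => apply_mem_regularAt (hs t ht) i j

/-- The loci other than the vanishing one satisfy `∏ (1 + λ_i) = det (I + H)`. -/
theorem IsEigenloci.prod_one_add {m : ℕ} {H : TransferMatrix (m + 1)} {c : ℝ → ℂ}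
    {l : Fin (m + 1) → ℝ → ℂ} (hl : IsEigenloci H c l) {t : ℝ} (ht : t ∈ Set.Icc (0 : ℝ) 2) :
    ∏ i : Fin m, (1 + l i.succ t) = (1 + evalAt H (c t)).det := by
  have h1 := congrArg (eval (-1)) (hl.eigen t ht)
  rw [Matrix.eval_charpoly, eval_prod] at h1
  have h2 : Matrix.scalar (Fin (m + 1)) (-1 : ℂ) - evalAt H (c t) = -(1 + evalAt H (c t)) := by
    rw [map_neg, map_one, neg_add, sub_eq_add_neg]
  have h3 : ∀ i, eval (-1) (X - C (l i t)) = (-1) * (1 + l i t) := fun i => by simp; ring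
  rw [h2, Matrix.det_neg, Finset.prod_congr rfl fun i _ => h3 i, Finset.prod_mul_distrib,
    Finset.prod_const, Finset.card_univ] at h1
  have h4 := mul_left_cancel₀ (pow_ne_zero _ (neg_ne_zero.2 one_ne_zero)) h1
  rw [h4, Fin.prod_univ_succ, hl.first t ht, add_zero, one_mul]

section Criterion

variable {m : ℕ} {H : TransferMatrix (m + 1)} {R ε : ℝ}

theorem not_isRoot_olCharPoly_nyquistContour
    (h : IsAdapted (olCharPoly H * clCharPoly H) (axisPoles H) R ε) {t : ℝ}
    (ht : t ∈ Set.Icc (0 : ℝ) 2) :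
    ¬ (olCharPoly H).IsRoot (nyquistContour (axisPoles H) R ε t) :=
  h.eval_nyquistContour_ne_zero (Dvd.intro _ rfl) (fun _ hz hre => mem_axisPoles hz hre) ht

/-- If no eigenlocus other than the vanishing one meets `-1`, then `φ_cl` has no root on the
imaginary axis: such a root is not an open-loop pole, so the contour runs through it. -/
theorem re_ne_zero_of_isRoot_clCharPoly
    (haxis : ∀ p : ℂ, p.re = 0 → ¬ ((olCharPoly H).IsRoot p ∧ (clCharPoly H).IsRoot p))
    (h : IsAdapted (olCharPoly H * clCharPoly H) (axisPoles H) R ε) {l : Fin (m + 1) → ℝ → ℂ}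
    (hl : IsEigenloci H (nyquistContour (axisPoles H) R ε) l)
    (hne : ∀ i : Fin m, ∀ t ∈ Set.Icc (0 : ℝ) 2, l i.succ t ≠ -1) {z : ℂ}
    (hz : (clCharPoly H).IsRoot z) : z.re ≠ 0 := by
  intro hre
  obtain ⟨t, ht, rfl⟩ := h.exists_nyquistContour_eq (hz.dvd (Dvd.intro_left _ rfl)) hre
    fun him => haxis z hre ⟨isRoot_of_mem_axisPoles hre him, hz⟩
  have hol := not_isRoot_olCharPoly_nyquistContour h ht
  have h1 := eval_olCharPoly_mul_det hol
  rw [hz, ← hl.prod_one_add ht] at h1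
  obtain ⟨i, -, hi⟩ := Finset.prod_eq_zero_iff.1 ((mul_eq_zero.1 h1).resolve_left hol)
  exact hne i t ht (eq_neg_of_add_eq_zero_right hi)

open Classical in
/-- The total argument change of the loci counts the unstable roots of `φ_ol` and of `φ_cl`. -/
theorem sum_argument_change (hdet : (1 + H).det ≠ 0)
    (h : IsAdapted (olCharPoly H * clCharPoly H) (axisPoles H) R ε)
    (hcl : ∀ z, (clCharPoly H).IsRoot z → z.re ≠ 0) {l : Fin (m + 1) → ℝ → ℂ}
    (hl : IsEigenloci H (nyquistContour (axisPoles H) R ε) l) {θ : Fin m → ℝ → ℝ}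
    (hθ : ∀ i, IsArgumentAboutNegOne (l i.succ) (θ i)) :
    ∑ i, (θ i 2 - θ i 0) = 2 * Real.pi * (numUnstablePoles H : ℝ) -
      2 * Real.pi * (((clCharPoly H).roots.filter fun p => 0 < p.re).card : ℝ) := by
  have hcl0 := clCharPoly_ne_zero hdet
  have hclaxis : ∀ z, (clCharPoly H).IsRoot z → z.re = 0 → z.im ∈ axisPoles H :=
    fun z hz hre => absurd hre (hcl z hz)
  have h1 := h.hasArgChange_eval (f := clCharPoly H) (Dvd.intro_left _ rfl) hcl0 hclaxis
  have h2 := h.hasArgChange_eval (f := olCharPoly H) (Dvd.intro _ rfl) (olCharPoly_ne_zero H)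
    (fun _ hz hre => mem_axisPoles hz hre)
  have h3 : HasArgChange (fun t => ∏ i : Fin m, (1 + l i.succ t)) 0 2 (∑ i, (θ i 2 - θ i 0)) :=
    HasArgChange.prod _ fun i _ => ⟨θ i, (hθ i).cont, (hθ i).polar, rfl⟩
  have heq : ∀ t ∈ Set.Icc (0 : ℝ) 2, ∏ i : Fin m, (1 + l i.succ t) =
      (clCharPoly H).eval (nyquistContour (axisPoles H) R ε t) *
        ((olCharPoly H).eval (nyquistContour (axisPoles H) R ε t))⁻¹ := fun t ht => by
    have hol := not_isRoot_olCharPoly_nyquistContour h ht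
    rw [hl.prod_one_add ht, eq_mul_inv_iff_mul_eq₀ hol, mul_comm]
    exact eval_olCharPoly_mul_det hol
  have h4 := HasArgChange.unique zero_le_two (fun t ht => by
    rw [heq t ht]
    exact mul_ne_zero (h.eval_nyquistContour_ne_zero (Dvd.intro_left _ rfl) hclaxis ht)
      (inv_ne_zero (not_isRoot_olCharPoly_nyquistContour h ht))) h3 ((h1.mul h2.inv).congr heq)
  rw [h4, numUnstablePoles]
  ring

/-- The generalized Nyquist criterion for a singular `H`: the eigenloci encircle `-1` as often as
there are unstable open-loop poles if and only if `φ_cl` has no root in the closed right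
half-plane. -/
theorem eigenlociEncircle_iff (hdet : (1 + H).det ≠ 0) (hH : H.det = 0)
    (haxis : ∀ p : ℂ, p.re = 0 → ¬ ((olCharPoly H).IsRoot p ∧ (clCharPoly H).IsRoot p))
    (h : IsAdapted (olCharPoly H * clCharPoly H) (axisPoles H) R ε) :
    EigenlociEncircle H (nyquistContour (axisPoles H) R ε) (numUnstablePoles H : ℤ) ↔
      ∀ p : ℂ, 0 ≤ p.re → ¬ (clCharPoly H).IsRoot p := by
  classical
  have hcl0 := clCharPoly_ne_zero hdet
  have hpi : 2 * Real.pi ≠ 0 := Real.two_pi_pos.ne'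
  constructor
  · rintro ⟨l, θ, hl, hne, hθ, hsum⟩ p hp hroot
    have hcl := fun z hz => re_ne_zero_of_isRoot_clCharPoly haxis h hl hne (z := z) hz
    rw [sum_argument_change hdet h hcl hl hθ] at hsum
    push_cast at hsum
    have hcard : (((clCharPoly H).roots.filter fun p => 0 < p.re).card : ℝ) = 0 :=
      (mul_eq_zero.1 (by linarith)).resolve_left hpi
    have hempty := Multiset.card_eq_zero.1 (Nat.cast_eq_zero.1 hcard)
    have hmem : p ∈ (clCharPoly H).roots.filter fun p => 0 < p.re :=
      Multiset.mem_filter.2 ⟨(mem_roots hcl0).2 hroot, lt_of_le_of_ne hp (hcl p hroot).symm⟩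
    rw [hempty] at hmem
    exact Multiset.notMem_zero p hmem
  · intro hst
    have hcl : ∀ z, (clCharPoly H).IsRoot z → z.re ≠ 0 := fun z hz hre => hst z hre.ge hz
    have hol := fun t ht => not_isRoot_olCharPoly_nyquistContour h (t := t) ht
    obtain ⟨l, hl1, hl2, hl3⟩ := exists_continuousOn_eigenvalues zero_le_two
      (continuousOn_evalAt h.continuous_nyquistContour hol) (fun t ht => by
        rw [det_evalAt (apply_mem_regularAt (hol t ht)), hH, RatFunc.eval_zero])
    have hl : IsEigenloci H (nyquistContour (axisPoles H) R ε) l := ⟨hl1, hl2, hl3⟩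
    have hne : ∀ i : Fin m, ∀ t ∈ Set.Icc (0 : ℝ) 2, 1 + l i.succ t ≠ 0 := by
      intro i t ht h0
      have h1 := eval_olCharPoly_mul_det (hol t ht)
      rw [← hl.prod_one_add ht, Finset.prod_eq_zero (Finset.mem_univ i) h0, mul_zero] at h1
      exact h.eval_nyquistContour_ne_zero (Dvd.intro_left _ rfl)
        (fun z hz hre => absurd hre (hcl z hz)) ht h1.symm
    choose θ hθ1 hθ2 using fun i : Fin m => exists_continuousOn_arg (γ := fun t => 1 + l i.succ t)
      zero_le_two (continuousOn_const.add (hl1 i.succ)) (hne i)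
    have hθ : ∀ i, IsArgumentAboutNegOne (l i.succ) (θ i) := fun i => ⟨hθ1 i, hθ2 i⟩
    refine ⟨l, θ, hl, fun i t ht h0 => hne i t ht (by rw [h0, add_neg_cancel]), hθ, ?_⟩
    have hempty : (clCharPoly H).roots.filter (fun p => 0 < p.re) = 0 :=
      Multiset.filter_eq_nil.2 fun p hp hre => hst p hre.le ((mem_roots hcl0).1 hp)
    rw [sum_argument_change hdet h hcl hl hθ, hempty]
    simp

end Criterion

/-- Without unstable cancellations, the loop `L' G'` has the unstable poles of the agents. -/
theorem NoUnstableCancellation.numUnstablePoles_eq {n : ℕ} {L : Matrix (Fin n) (Fin n) ℝ}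
    {g : Fin n → RatFunc ℂ} (h : NoUnstableCancellation L g) :
    numUnstablePoles (loopMatrix L g) = numUnstablePoles (normAgents L g) := by
  classical
  unfold numUnstablePoles
  congr 1
  ext p
  by_cases hp : 0 < p.re
  · rw [Multiset.count_filter_of_pos (p := fun p : ℂ => 0 < p.re) hp,
      Multiset.count_filter_of_pos (p := fun p : ℂ => 0 < p.re) hp, count_roots, count_roots,
      h p hp]
  · rw [Multiset.count_filter_of_neg (p := fun p : ℂ => 0 < p.re) hp,
      Multiset.count_filter_of_neg (p := fun p : ℂ => 0 < p.re) hp]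

end

end NetworkSync

theorem mainTheorem1 (m : ℕ) (hm : 2 ≤ m + 1)
    (L : Matrix (Fin (m + 1)) (Fin (m + 1)) ℝ) (hL : NetworkSync.IsConnectedLaplacian L)
    (g : Fin (m + 1) → RatFunc ℂ) (hg : ∀ i, NetworkSync.IsProper (g i))
    (hwp : NetworkSync.WellPosed L g)
    (hcancel : NetworkSync.NoUnstableCancellation L g)
    (haxis : NetworkSync.NoAxisCancellation L g)
    (U : Matrix (Fin (m + 1)) (Fin (m + 1)) ℝ) (μ : Fin (m + 1) → ℝ)
    (hU : NetworkSync.IsModalDecomposition (NetworkSync.normLaplacian L) U μ)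
    (N : ℕ) (hN : NetworkSync.numUnstablePoles (NetworkSync.normAgents L g) = N) :
    NetworkSync.AsymptoticSync L g U ↔
      ∃ R₀ > (0 : ℝ), ∃ ε₀ > (0 : ℝ), ∀ R > R₀, ∀ ε : ℝ, 0 < ε → ε < ε₀ →
        NetworkSync.EigenlociEncircle (NetworkSync.loopMatrix L g)
          (NetworkSync.nyquistContour (NetworkSync.axisPoles (NetworkSync.loopMatrix L g)) R ε)
          (N : ℤ) := by
  have hdet := NetworkSync.det_one_add_loopMatrix_ne_zero hg hwp
  have hH := NetworkSync.det_loopMatrix hL hm g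
  rw [← hcancel.numUnstablePoles_eq] at hN
  subst hN
  rw [NetworkSync.asymptoticSync_iff_clCharPoly hL hm hU hdet]
  have hol0 := NetworkSync.olCharPoly_ne_zero (NetworkSync.loopMatrix L g)
  have hcl0 := NetworkSync.clCharPoly_ne_zero hdet
  obtain ⟨R₀, hR₀, ε₀, hε₀, had⟩ := NetworkSync.exists_isAdapted (mul_ne_zero hol0 hcl0)
    (NetworkSync.axisPoles (NetworkSync.loopMatrix L g))
  constructor
  · exact fun h => ⟨R₀, hR₀, ε₀, hε₀, fun R hR ε h1 h2 =>
      (NetworkSync.eigenlociEncircle_iff hdet hH haxis (had R hR ε h1 h2)).2 h⟩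
  · rintro ⟨R₁, hR₁, ε₁, hε₁, h⟩
    -- one contour that is large enough and indented finely enough for both purposes
    have hmin : 0 < min ε₀ ε₁ := lt_min hε₀ hε₁
    have hR0 : R₀ < max R₀ R₁ + 1 := (le_max_left _ _).trans_lt (lt_add_one _)
    have hR1 : R₁ < max R₀ R₁ + 1 := (le_max_right _ _).trans_lt (lt_add_one _)
    exact (NetworkSync.eigenlociEncircle_iff hdet hH haxis
      (had _ hR0 _ (half_pos hmin) ((half_lt_self hmin).trans_le (min_le_left _ _)))).1
      (h _ hR1 _ (half_pos hmin) ((half_lt_self hmin).trans_le (min_le_right _ _)))
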